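/- Consider the real memoryless channel $Y=f(X)+N$ with input $X\in\mathbb R$ and noise $N$ independent of $X$, where $N$ has a probability density $p_N$, under the average cost constraint $\mathbb E[\mathcal C(|X|)]\le A$ with $A>0$. For real functions $g,h$ on $\mathbb R$ write $g(x)=\omega(h(x))$ if for every $\kappa>0$ there is $c>0$ such that $|g(x)|\ge\kappa|h(x)|$ whenever $|x|\ge c$. Put $$p_l(x)=\begin{cases}\inf_{0\le t\le x}p_N(t)&x\ge0\\ \inf_{x\le t\le0}p_N(t)&x<0\end{cases},\qquad p_u(x)=\begin{cases}\sup_{t\ge x}p_N(t)&x\ge0\\ \sup_{t\le x}p_N(t)&x<0\end{cases},\qquad L(x)=\ln\frac1{p_l(x)}.$$ Assume: - (C1) $f:\mathbb R\to\mathbb R$ is continuous. - (C2) $|f(x)|$ is a non-decreasing function of $|x|$, and $|f(x)|\to\infty$ as $|x|\to\infty$. - (C3) $\mathcal C:[0,\infty)\to\mathbb R$ is lower semicontinuous and non-decreasing, with $\mathcal C(0)=0$. - (C4) $\mathcal C(|x|)=\omega(\ln|f(x)|)$. - (C5) $p_N$ is positive, continuous and bounded on $\mathbb R$. - (C6) There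 is a non-decreasing $\mathcal C_N:[0,\infty)\to\mathbb R$ with $\mathcal C_N(|x|)=\omega(\ln|x|)$ and $\mathbb E[\mathcal C_N(|N|)]<\infty$. - (C7) There are $\kappa_l>0$ and $R$ such that $L(x+y)\le\kappa_l\,(L(x)+L(y))$ whenever $|x|,|y|\ge R$. - (C8) The integral $-\int_{-\infty}^{\infty}p_u(x)\ln p_l(x)\,dx$ exists and is finite. The capacity is the supremum of the mutual information $I(X;Y)$ over all probability distributions $F$ of $X$ with $\int\mathcal C(|x|)\,dF(x)\le A$; such an $F$ that attains the supremum is called capacity-achieving. If $\mathcal C(|x|)=\omega\left(\ln\frac1{p_l(f(x))}\right)$, then the capacity is finite, a capacity-achieving input distribution exists, and the support of every capacity-achieving input distribution (the set of points all of whose neighbourhoods have positive probability) is compact. -/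

import Mathlib

open MeasureTheory Filter Asymptotics
open scoped ENNReal NNReal

noncomputable section

/-- The monotone lower envelope of the noise density `p`: the infimum of `p` over the closed
interval between `0` and `x`. -/
def lowerEnvelope (p : ℝ → ℝ) (x : ℝ) : ℝ :=
  if 0 ≤ x then sInf (p '' Set.Icc 0 x) else sInf (p '' Set.Icc x 0)

/-- The monotone upper envelope of the noise density `p`: the supremum of `p` over `[x, ∞)` for
`0 ≤ x`, and over `(-∞, x]` for `x < 0`. -/
def upperEnvelope (p : ℝ → ℝ) (x : ℝ) : ℝ :=
  if 0 ≤ x then sSup (p '' Set.Ici x) else sSup (p '' Set.Iic x)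

/-- `L(x) = ln (1 / p_l(x))`, with `p_l` the lower envelope of `p`. -/
def logInvLower (p : ℝ → ℝ) (x : ℝ) : ℝ := Real.log (1 / lowerEnvelope p x)

/-- The law of the noise `N`: the measure on `ℝ` with Lebesgue density `p`. -/
def noiseLaw (p : ℝ → ℝ) : Measure ℝ :=
  volume.withDensity fun y => ENNReal.ofReal (p y)

/-- The joint law of `(X, Y)`, where `X` has law `F`, `N` has density `p` and is independent of
`X`, and `Y = f(X) + N`. -/
def jointLaw (f p : ℝ → ℝ) (F : Measure ℝ) : Measure (ℝ × ℝ) :=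
  (F.prod (noiseLaw p)).map fun z => (z.1, f z.1 + z.2)

/-- The law of the channel output `Y = f(X) + N` when `X` has law `F`. -/
def outputLaw (f p : ℝ → ℝ) (F : Measure ℝ) : Measure ℝ :=
  (jointLaw f p F).map Prod.snd

/-- The mutual information (in nats) between the input `X` and the output `Y = f(X) + N` when `X`
has law `F`: the Kullback-Leibler divergence of the joint law of `(X, Y)` from the product of its
marginals. -/
def mutualInfo (f p : ℝ → ℝ) (F : Measure ℝ) : ℝ≥0∞ :=
  InformationTheory.klDiv (jointLaw f p F) (F.prod (outputLaw f p F))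

/-- The input laws `F` with `∫ C(|x|) dF(x) ≤ A`. -/
def feasible (C : ℝ≥0 → ℝ) (A : ℝ) : Set (ProbabilityMeasure ℝ) :=
  {F | Integrable (fun x : ℝ => C ‖x‖₊) (F : Measure ℝ) ∧ ∫ x : ℝ, C ‖x‖₊ ∂(F : Measure ℝ) ≤ A}

/-- The capacity of the channel `Y = f(X) + N` under the average cost constraint. -/
def capacity (f p : ℝ → ℝ) (C : ℝ≥0 → ℝ) (A : ℝ) : ℝ≥0∞ :=
  ⨆ F ∈ feasible C A, mutualInfo f p (F : Measure ℝ)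

/-- `F` is a capacity-achieving input law. -/
def IsCapacityAchieving (f p : ℝ → ℝ) (C : ℝ≥0 → ℝ) (A : ℝ) (F : ProbabilityMeasure ℝ) : Prop :=
  F ∈ feasible C A ∧ mutualInfo f p (F : Measure ℝ) = capacity f p C A

end

/-!
# Compactly supported optimal inputs for an additive noise channel

Write `D(x, q)` for the relative entropy of the output law given the input `x` with respect to the
density `q` (`condDiv`), and `q_F` for the output density under the input law `F`
(`outputDensity`). The mutual information is the mean of `D(x, q_F)`
(`mutualInfo_eq_lintegral_condDiv`), and for every positive reference density `q` the compensation
identity `∫ D(x, q) dF = I(F) + D(q_F, q)` holds (`lintegral_condDiv_eq_mutualInfo_add`).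

*Finiteness and existence.* For `q(y) = 1 / (1 + y²)` the function `D(·, q)` is continuous and
grows like `log (1 + f²)`, hence is negligible with respect to the cost. So `∫ D(x, q) dF` is
bounded and weakly upper semicontinuous on the feasible set, while `D(q_F, q)` is weakly lower
semicontinuous by Fatou's lemma; their difference `I(F)` is upper semicontinuous
(`liminf_mutualInfo_le`). The cost tends to infinity, so the feasible set is compact by Prokhorov's
theorem, and a maximizer exists.

*Compact support.* Let `F` be optimal. Comparison with mixtures gives `∫ D(x, q_F) dG ≤ I(F)` for
every feasible `G` (`lintegral_condDiv_le_capacity`). Testing this on laws with two atoms yields a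
multiplier `ν ≥ 0` with `D(x, q_F) ≤ I(F) + ν (C(|x|) - A)` for all `x`, with equality for
`F`-almost every `x` (`exists_kkt_multiplier`). The function `D(·, q_F)` is unbounded
(`exists_le_condDiv_add_one`), so `ν > 0`. On the other hand `q_F` is bounded below in terms of the
lower envelope of the noise density, and quasi-subadditivity of `L` gives
`D(x, q_F) = O(1 + L(f(x)))` (`exists_toReal_condDiv_le`), which is negligible with respect to the
cost. Hence equality fails for large `|x|`, and `F` is carried by a compact set.
-/

/-! ### The relative entropy integrand -/

/-- The integrand `a log (a / b) + b - a` of the relative entropy between densities taking the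
values `a` and `b`. The correction `b - a` integrates to `0` for probability densities and makes
the integrand nonnegative, so that all divergences can be Lebesgue integrals in `ℝ≥0∞`. -/
noncomputable def relEnt (a b : ℝ) : ℝ := a * Real.log a - a * Real.log b + b - a

lemma relEnt_eq_mul_klFun {a b : ℝ} (ha : 0 < a) (hb : 0 < b) :
    relEnt a b = b * InformationTheory.klFun (a / b) := by
  rw [relEnt, InformationTheory.klFun_apply, Real.log_div ha.ne' hb.ne']
  field_simp

lemma relEnt_nonneg {a b : ℝ} (ha : 0 < a) (hb : 0 < b) : 0 ≤ relEnt a b := by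
  rw [relEnt_eq_mul_klFun ha hb]
  exact mul_nonneg hb.le (InformationTheory.klFun_nonneg (div_nonneg ha.le hb.le))

/-- The variational (Donsker–Varadhan) lower bound on the relative entropy integrand. -/
lemma mul_sub_mul_exp_le_relEnt {a b : ℝ} (ha : 0 < a) (hb : 0 < b) (t : ℝ) :
    a * t - b * (Real.exp t - 1) ≤ relEnt a b := by
  have h := relEnt_nonneg ha (mul_pos hb (Real.exp_pos t))
  rw [relEnt, Real.log_mul hb.ne' (Real.exp_pos t).ne', Real.log_exp] at h
  rw [relEnt]
  linarith

lemma Measurable.relEnt {α : Type*} {mα : MeasurableSpace α} {u v : α → ℝ} (hu : Measurable u)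
    (hv : Measurable v) : Measurable fun x => relEnt (u x) (v x) :=
  (((hu.mul hu.log).sub (hu.mul hv.log)).add hv).sub hu

lemma Filter.Tendsto.relEnt {α : Type*} {l : Filter α} {u v : α → ℝ} {a b : ℝ}
    (hu : Tendsto u l (nhds a)) (hv : Tendsto v l (nhds b)) (hb : b ≠ 0) :
    Tendsto (fun x => relEnt (u x) (v x)) l (nhds (relEnt a b)) :=
  ((((Real.continuous_mul_log.tendsto a).comp hu).sub (hu.mul (hv.log hb))).add hv).sub hu

/-- Pointwise form of the compensation identity: replacing the mean of `g` by another reference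
value `b` costs exactly the relative entropy of the mean with respect to `b`. -/
lemma lintegral_relEnt_eq_add {α : Type*} {mα : MeasurableSpace α} (F : Measure α)
    [IsProbabilityMeasure F] {g : α → ℝ} (hg : Measurable g) (hpos : ∀ x, 0 < g x) {M : ℝ}
    (hM : ∀ x, g x ≤ M) (hm : 0 < ∫ x, g x ∂F) {b : ℝ} (hb : 0 < b) :
    ∫⁻ x, ENNReal.ofReal (relEnt (g x) b) ∂F
      = ∫⁻ x, ENNReal.ofReal (relEnt (g x) (∫ x, g x ∂F)) ∂F
        + ENNReal.ofReal (relEnt (∫ x, g x ∂F) b) := by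
  set m := ∫ x, g x ∂F with hm_def
  have hint : Integrable g F := by
    refine Integrable.of_bound hg.aestronglyMeasurable M (ae_of_all _ fun x => ?_)
    rw [Real.norm_of_nonneg (hpos x).le]; exact hM x
  have hlog : Integrable (fun x => g x * Real.log (g x)) F := by
    obtain ⟨K, hK⟩ := isCompact_Icc.exists_bound_of_continuousOn (s := Set.Icc 0 M)
      Real.continuous_mul_log.continuousOn
    refine Integrable.of_bound (Real.continuous_mul_log.measurable.comp hg).aestronglyMeasurable K
      (ae_of_all _ fun x => hK _ ⟨(hpos x).le, hM x⟩)
  have key : ∀ c : ℝ, Integrable (fun x => relEnt (g x) c) F ∧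
      ∫ x, relEnt (g x) c ∂F = ∫ x, g x * Real.log (g x) ∂F - m * Real.log c + c - m := by
    intro c
    have h1 : Integrable (fun x => g x * Real.log c) F := hint.mul_const _
    refine ⟨((hlog.sub h1).add (integrable_const c)).sub hint, ?_⟩
    unfold relEnt
    rw [integral_sub, integral_add, integral_sub, integral_mul_const, integral_const]
    · simp [hm_def]
    exacts [hlog, h1, hlog.sub h1, integrable_const c, (hlog.sub h1).add (integrable_const c), hint]
  rw [← ofReal_integral_eq_lintegral_ofReal (key b).1
      (ae_of_all _ fun x => relEnt_nonneg (hpos x) hb),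
    ← ofReal_integral_eq_lintegral_ofReal (key m).1
      (ae_of_all _ fun x => relEnt_nonneg (hpos x) hm),
    ← ENNReal.ofReal_add (integral_nonneg fun x => relEnt_nonneg (hpos x) hm) (relEnt_nonneg hm hb),
    (key b).2, (key m).2]
  congr 1
  rw [relEnt]
  ring

/-! ### Mutual information through densities -/

/-- A positive, continuous, bounded probability density on the real line. -/
structure IsNoiseDensity (p : ℝ → ℝ) : Prop where
  pos : ∀ x, 0 < p x
  continuous : Continuous p
  bdd : ∃ M : ℝ, ∀ x, p x ≤ M
  integrable : Integrable p
  integral_eq_one : ∫ x, p x = 1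

/-- The density `y ↦ 𝔼 p(y - f(X))` of the channel output when `X` has law `F`. -/
noncomputable def outputDensity (f p : ℝ → ℝ) (F : Measure ℝ) (y : ℝ) : ℝ := ∫ x, p (y - f x) ∂F

/-- The relative entropy of the output law given the input `x` with respect to the measure with
density `q`, corrected by the difference of the total masses. -/
noncomputable def condDiv (f p q : ℝ → ℝ) (x : ℝ) : ℝ≥0∞ :=
  ∫⁻ y, ENNReal.ofReal (relEnt (p (y - f x)) (q y))

section Channel

variable {f p : ℝ → ℝ} (F : Measure ℝ)

lemma IsNoiseDensity.lintegral_eq_one (hp : IsNoiseDensity p) :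
    ∫⁻ x, ENNReal.ofReal (p x) = 1 := by
  rw [← ofReal_integral_eq_lintegral_ofReal hp.integrable (ae_of_all _ fun x => (hp.pos x).le),
    hp.integral_eq_one, ENNReal.ofReal_one]

lemma IsNoiseDensity.lintegral_sub_eq_one (hp : IsNoiseDensity p) (a : ℝ) :
    ∫⁻ x, ENNReal.ofReal (p (x - a)) = 1 := by
  rw [lintegral_sub_right_eq_self (fun x => ENNReal.ofReal (p x)) a, hp.lintegral_eq_one]

lemma IsNoiseDensity.measurable_comp (hp : IsNoiseDensity p) (hf : Measurable f) :
    Measurable fun z : ℝ × ℝ => p (z.2 - f z.1) :=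
  hp.continuous.measurable.comp (measurable_snd.sub (hf.comp measurable_fst))

lemma IsNoiseDensity.integrable_comp [IsFiniteMeasure F] (hp : IsNoiseDensity p)
    (hf : Measurable f) (y : ℝ) : Integrable (fun x => p (y - f x)) F := by
  obtain ⟨M, hM⟩ := hp.bdd
  refine Integrable.of_bound
    (hp.continuous.measurable.comp (measurable_const.sub hf)).aestronglyMeasurable M
    (ae_of_all _ fun x => ?_)
  rw [Real.norm_of_nonneg (hp.pos _).le]
  exact hM _

lemma outputDensity_pos [IsProbabilityMeasure F] (hp : IsNoiseDensity p) (hf : Measurable f)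
    (y : ℝ) : 0 < outputDensity f p F y := by
  rw [outputDensity, integral_pos_iff_support_of_nonneg (fun x => (hp.pos _).le)
    (hp.integrable_comp F hf y)]
  have : Function.support (fun x => p (y - f x)) = Set.univ :=
    Set.eq_univ_of_forall fun x => (hp.pos _).ne'
  simp [this]

lemma measurable_outputDensity [IsProbabilityMeasure F] (hp : IsNoiseDensity p)
    (hf : Measurable f) : Measurable (outputDensity f p F) := by
  have h : StronglyMeasurable fun z : ℝ × ℝ => p (z.1 - f z.2) :=
    ((hp.measurable_comp hf).comp measurable_swap).stronglyMeasurable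
  exact h.integral_prod_right.measurable

lemma ofReal_outputDensity [IsProbabilityMeasure F] (hp : IsNoiseDensity p) (hf : Measurable f)
    (y : ℝ) : ENNReal.ofReal (outputDensity f p F y) = ∫⁻ x, ENNReal.ofReal (p (y - f x)) ∂F :=
  ofReal_integral_eq_lintegral_ofReal (hp.integrable_comp F hf y)
    (ae_of_all _ fun _ => (hp.pos _).le)

lemma lintegral_outputDensity [IsProbabilityMeasure F] (hp : IsNoiseDensity p)
    (hf : Measurable f) : ∫⁻ y, ENNReal.ofReal (outputDensity f p F y) = 1 := by
  simp_rw [ofReal_outputDensity F hp hf]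
  rw [lintegral_lintegral_swap]
  · simp [hp.lintegral_sub_eq_one]
  · exact ((hp.measurable_comp hf).comp measurable_swap).ennreal_ofReal.aemeasurable

lemma integrable_outputDensity [IsProbabilityMeasure F] (hp : IsNoiseDensity p)
    (hf : Measurable f) : Integrable (outputDensity f p F) := by
  refine ⟨(measurable_outputDensity F hp hf).aestronglyMeasurable, ?_⟩
  rw [hasFiniteIntegral_iff_ofReal (ae_of_all _ fun y => (outputDensity_pos F hp hf y).le),
    lintegral_outputDensity F hp hf]
  exact ENNReal.one_lt_top

lemma integral_outputDensity [IsProbabilityMeasure F] (hp : IsNoiseDensity p)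
    (hf : Measurable f) : ∫ y, outputDensity f p F y = 1 := by
  rw [integral_eq_lintegral_of_nonneg_ae (ae_of_all _ fun y => (outputDensity_pos F hp hf y).le)
    (measurable_outputDensity F hp hf).aestronglyMeasurable, lintegral_outputDensity F hp hf,
    ENNReal.toReal_one]

lemma isProbabilityMeasure_noiseLaw (hp : IsNoiseDensity p) :
    IsProbabilityMeasure (noiseLaw p) := by
  constructor
  rw [noiseLaw, withDensity_apply _ .univ, Measure.restrict_univ, hp.lintegral_eq_one]

instance noiseLaw.instSFinite : SFinite (noiseLaw p) := by
  unfold noiseLaw; infer_instance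

lemma lintegral_jointLaw [SFinite F] (hp : IsNoiseDensity p) (hf : Measurable f)
    {g : ℝ × ℝ → ℝ≥0∞} (hg : Measurable g) :
    ∫⁻ z, g z ∂(jointLaw f p F)
      = ∫⁻ x, ∫⁻ y, ENNReal.ofReal (p (y - f x)) * g (x, y) ∂volume ∂F := by
  have hsh : Measurable fun z : ℝ × ℝ => (z.1, f z.1 + z.2) := by fun_prop
  rw [jointLaw, lintegral_map hg hsh,
    lintegral_prod (fun z => g (z.1, f z.1 + z.2)) (hg.comp hsh).aemeasurable]
  refine lintegral_congr fun x => ?_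
  have hgx : Measurable fun n => g (x, f x + n) := hg.comp (hsh.comp measurable_prodMk_left)
  rw [noiseLaw, lintegral_withDensity_eq_lintegral_mul _ hp.continuous.measurable.ennreal_ofReal
    hgx, ← lintegral_sub_right_eq_self _ (f x)]
  refine lintegral_congr fun y => ?_
  simp

lemma outputLaw_eq_withDensity [IsProbabilityMeasure F] (hp : IsNoiseDensity p)
    (hf : Measurable f) : outputLaw f p F
      = volume.withDensity fun y => ENNReal.ofReal (outputDensity f p F y) := by
  refine Measure.ext_of_lintegral _ fun g hg => ?_
  rw [outputLaw, lintegral_map hg measurable_snd,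
    lintegral_jointLaw F hp hf (g := fun z => g z.2) (hg.comp measurable_snd),
    lintegral_withDensity_eq_lintegral_mul _ (measurable_outputDensity F hp hf).ennreal_ofReal hg,
    lintegral_lintegral_swap
      ((hp.measurable_comp hf).ennreal_ofReal.mul (hg.comp measurable_snd)).aemeasurable]
  refine lintegral_congr fun y => ?_
  rw [Pi.mul_apply, ofReal_outputDensity F hp hf]
  exact lintegral_mul_const (g y) (f := fun x => ENNReal.ofReal (p (y - f x)))
    (hp.continuous.measurable.comp (measurable_const.sub hf)).ennreal_ofReal

lemma measurable_relEnt_comp (hp : IsNoiseDensity p) (hf : Measurable f) {q : ℝ → ℝ}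
    (hq : Measurable q) :
    Measurable fun z : ℝ × ℝ => ENNReal.ofReal (relEnt (p (z.2 - f z.1)) (q z.2)) :=
  ((hp.measurable_comp hf).relEnt (hq.comp measurable_snd)).ennreal_ofReal

lemma measurable_condDiv (hp : IsNoiseDensity p) (hf : Measurable f) {q : ℝ → ℝ}
    (hq : Measurable q) : Measurable (condDiv f p q) :=
  (measurable_relEnt_comp hp hf hq).lintegral_prod_right'

/-- The mutual information is the mean divergence of the conditional output law from the output
law. -/
theorem mutualInfo_eq_lintegral_condDiv [IsProbabilityMeasure F] (hp : IsNoiseDensity p)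
    (hf : Measurable f) :
    mutualInfo f p F = ∫⁻ x, condDiv f p (outputDensity f p F) x ∂F := by
  set q := outputDensity f p F with hq_def
  have hq : Measurable q := measurable_outputDensity F hp hf
  have hqpos : ∀ y, 0 < q y := outputDensity_pos F hp hf
  have hQ : outputLaw f p F = volume.withDensity fun y => ENNReal.ofReal (q y) :=
    outputLaw_eq_withDensity F hp hf
  have : IsProbabilityMeasure (outputLaw f p F) := by
    constructor
    rw [hQ, withDensity_apply _ .univ, Measure.restrict_univ, lintegral_outputDensity F hp hf]
  have := isProbabilityMeasure_noiseLaw hp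
  have : IsFiniteMeasure (jointLaw f p F) := by
    unfold jointLaw; infer_instance
  -- integration against the product of the marginals
  have hprod : ∀ g : ℝ × ℝ → ℝ≥0∞, Measurable g →
      ∫⁻ z, g z ∂(F.prod (outputLaw f p F))
        = ∫⁻ x, ∫⁻ y, ENNReal.ofReal (q y) * g (x, y) ∂volume ∂F := by
    intro g hg
    rw [lintegral_prod _ hg.aemeasurable]
    refine lintegral_congr fun x => ?_
    have hgx : Measurable fun y => g (x, y) := hg.comp measurable_prodMk_left
    rw [hQ, lintegral_withDensity_eq_lintegral_mul _ hq.ennreal_ofReal hgx]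
    rfl
  set r : ℝ × ℝ → ℝ := fun z => p (z.2 - f z.1) / q z.2 with hr_def
  have hr : Measurable r := (hp.measurable_comp hf).div (hq.comp measurable_snd)
  have hrpos : ∀ z, 0 < r z := fun z => div_pos (hp.pos _) (hqpos _)
  have hjoint : jointLaw f p F
      = (F.prod (outputLaw f p F)).withDensity fun z => ENNReal.ofReal (r z) := by
    refine Measure.ext_of_lintegral _ fun g hg => ?_
    rw [lintegral_jointLaw F hp hf hg,
      lintegral_withDensity_eq_lintegral_mul _ hr.ennreal_ofReal hg,
      hprod _ (hr.ennreal_ofReal.mul hg)]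
    refine lintegral_congr fun x => lintegral_congr fun y => ?_
    rw [Pi.mul_apply, ← mul_assoc, ← ENNReal.ofReal_mul (hqpos y).le]
    congr 2
    simp only [hr_def]
    rw [mul_div_cancel₀ _ (hqpos y).ne']
  have hac : jointLaw f p F ≪ F.prod (outputLaw f p F) := by
    rw [hjoint]; exact withDensity_absolutelyContinuous _ _
  have hrn : (jointLaw f p F).rnDeriv (F.prod (outputLaw f p F))
      =ᵐ[F.prod (outputLaw f p F)] fun z => ENNReal.ofReal (r z) := by
    conv_lhs => rw [hjoint]
    exact Measure.rnDeriv_withDensity _ hr.ennreal_ofReal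
  rw [mutualInfo, InformationTheory.klDiv_eq_lintegral_klFun_of_ac hac,
    lintegral_congr_ae (g := fun z => ENNReal.ofReal (InformationTheory.klFun (r z))),
    hprod (fun z => ENNReal.ofReal (InformationTheory.klFun (r z)))
      (InformationTheory.measurable_klFun.comp hr).ennreal_ofReal]
  · refine lintegral_congr fun x => lintegral_congr fun y => ?_
    rw [← ENNReal.ofReal_mul (hqpos y).le, relEnt_eq_mul_klFun (hp.pos _) (hqpos y)]
  · filter_upwards [hrn] with z hz
    rw [hz, ENNReal.toReal_ofReal (hrpos z).le]

/-- The compensation identity: the mean divergence from a reference density `q` exceeds the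
mutual information by the divergence of the output law from `q`. -/
theorem lintegral_condDiv_eq_mutualInfo_add [IsProbabilityMeasure F] (hp : IsNoiseDensity p)
    (hf : Measurable f) {q : ℝ → ℝ} (hq : Measurable q) (hqpos : ∀ y, 0 < q y) :
    ∫⁻ x, condDiv f p q x ∂F = mutualInfo f p F
      + ∫⁻ y, ENNReal.ofReal (relEnt (outputDensity f p F y) (q y)) := by
  have hout := measurable_outputDensity F hp hf
  have hD : Measurable fun y => ENNReal.ofReal (relEnt (outputDensity f p F y) (q y)) :=
    (hout.relEnt hq).ennreal_ofReal
  rw [mutualInfo_eq_lintegral_condDiv F hp hf]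
  unfold condDiv
  rw [lintegral_lintegral_swap (measurable_relEnt_comp hp hf hq).aemeasurable,
    lintegral_lintegral_swap (f := fun x y => ENNReal.ofReal
      (relEnt (p (y - f x)) (outputDensity f p F y)))
      (measurable_relEnt_comp hp hf hout).aemeasurable,
    ← lintegral_add_right _ hD]
  obtain ⟨M, hM⟩ := hp.bdd
  exact lintegral_congr fun y => lintegral_relEnt_eq_add F
    (hp.continuous.measurable.comp (measurable_const.sub hf)) (fun x => hp.pos _) (fun x => hM _)
    (outputDensity_pos F hp hf y) (hqpos y)

/-- Lower semicontinuity of the mean divergence in the reference density, by Fatou's lemma. -/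
lemma lintegral_condDiv_le_liminf [SFinite F] (hp : IsNoiseDensity p) (hf : Measurable f)
    {q : ℝ → ℝ} (hqpos : ∀ y, 0 < q y) {qs : ℕ → ℝ → ℝ} (hqs : ∀ n, Measurable (qs n))
    (hlim : ∀ y, Tendsto (fun n => qs n y) atTop (nhds (q y))) :
    ∫⁻ x, condDiv f p q x ∂F ≤ liminf (fun n => ∫⁻ x, condDiv f p (qs n) x ∂F) atTop := by
  have hlim' : ∀ x y, Tendsto (fun n => ENNReal.ofReal (relEnt (p (y - f x)) (qs n y))) atTop
      (nhds (ENNReal.ofReal (relEnt (p (y - f x)) (q y)))) := fun x y =>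
    ENNReal.tendsto_ofReal (tendsto_const_nhds.relEnt (hlim y) (hqpos y).ne')
  have hm : ∀ x n, Measurable fun y => ENNReal.ofReal (relEnt (p (y - f x)) (qs n y)) := fun x n =>
    ((hp.continuous.measurable.comp (measurable_id.sub_const _)).relEnt (hqs n)).ennreal_ofReal
  calc ∫⁻ x, condDiv f p q x ∂F
      ≤ ∫⁻ x, liminf (fun n => condDiv f p (qs n) x) atTop ∂F := by
        refine lintegral_mono fun x => ?_
        calc condDiv f p q x = ∫⁻ y, liminf
              (fun n => ENNReal.ofReal (relEnt (p (y - f x)) (qs n y))) atTop :=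
              lintegral_congr fun y => (hlim' x y).liminf_eq.symm
          _ ≤ liminf (fun n => condDiv f p (qs n) x) atTop := lintegral_liminf_le (hm x)
    _ ≤ _ := lintegral_liminf_le fun n => measurable_condDiv hp hf (hqs n)

end Channel

/-! ### Weak convergence and the feasible set -/

/-- The portmanteau inequality for nonnegative lower semicontinuous functions: the superlevel sets
are open, so the layer cake formula and Fatou's lemma reduce it to open sets. -/
lemma LowerSemicontinuous.lintegral_le_liminf {Ω : Type*} [TopologicalSpace Ω]
    [MeasurableSpace Ω] [OpensMeasurableSpace Ω] [HasOuterApproxClosed Ω] {h : Ω → ℝ}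
    (h_lsc : LowerSemicontinuous h) (h_nonneg : 0 ≤ h) {F : ProbabilityMeasure Ω}
    {Fs : ℕ → ProbabilityMeasure Ω} (hlim : Tendsto Fs atTop (nhds F)) :
    ∫⁻ x, ENNReal.ofReal (h x) ∂(F : Measure Ω)
      ≤ liminf (fun n => ∫⁻ x, ENNReal.ofReal (h x) ∂(Fs n : Measure Ω)) atTop := by
  have hopen : ∀ t, IsOpen {a | t < h a} := fun t => h_lsc.isOpen_preimage t
  have hmeas : Measurable h := h_lsc.measurable
  simp_rw [lintegral_eq_lintegral_meas_lt _ (Eventually.of_forall h_nonneg) hmeas.aemeasurable]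
  refine (lintegral_mono fun t =>
    ProbabilityMeasure.le_liminf_measure_open_of_tendsto hlim (hopen t)).trans
    (lintegral_liminf_le fun n => Antitone.measurable fun s t hst =>
      measure_mono fun ω hω => lt_of_le_of_lt hst hω)

section Feasible

variable {C : ℝ≥0 → ℝ} {A : ℝ}

lemma lowerSemicontinuous_cost (hC : LowerSemicontinuous C) :
    LowerSemicontinuous fun x : ℝ => C ‖x‖₊ :=
  LowerSemicontinuous.comp hC continuous_nnnorm

lemma mem_feasible_iff (hC : LowerSemicontinuous C) (hC0 : ∀ r, 0 ≤ C r) (hA : 0 ≤ A)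
    (F : ProbabilityMeasure ℝ) : F ∈ feasible C A ↔
      ∫⁻ x : ℝ, ENNReal.ofReal (C ‖x‖₊) ∂(F : Measure ℝ) ≤ ENNReal.ofReal A := by
  have hm : Measurable fun x : ℝ => C ‖x‖₊ := (lowerSemicontinuous_cost hC).measurable
  have h0 : 0 ≤ᵐ[(F : Measure ℝ)] fun x : ℝ => C ‖x‖₊ := ae_of_all _ fun x => hC0 _
  constructor
  · rintro ⟨hi, hle⟩
    rw [← ofReal_integral_eq_lintegral_ofReal hi h0]
    exact ENNReal.ofReal_le_ofReal hle
  · intro h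
    have hi : Integrable (fun x : ℝ => C ‖x‖₊) (F : Measure ℝ) := by
      refine ⟨hm.aestronglyMeasurable, ?_⟩
      rw [hasFiniteIntegral_iff_ofReal h0]
      exact h.trans_lt ENNReal.ofReal_lt_top
    refine ⟨hi, ?_⟩
    rw [← ofReal_integral_eq_lintegral_ofReal hi h0] at h
    exact (ENNReal.ofReal_le_ofReal_iff hA).1 h

lemma isClosed_feasible (hC : LowerSemicontinuous C) (hC0 : ∀ r, 0 ≤ C r) (hA : 0 ≤ A) :
    IsClosed (feasible C A) := by
  refine IsSeqClosed.isClosed fun Fs F hFs hlim => ?_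
  rw [mem_feasible_iff hC hC0 hA]
  refine ((lowerSemicontinuous_cost hC).lintegral_le_liminf (fun x => hC0 _) hlim).trans ?_
  refine liminf_le_of_frequently_le' (Frequently.of_forall fun n => ?_)
  exact (mem_feasible_iff hC hC0 hA _).1 (hFs n)

/-- A cost growing to infinity makes the feasible set tight, by Markov's inequality, hence compact
by Prokhorov's theorem. -/
lemma isCompact_feasible (hC : LowerSemicontinuous C) (hC0 : ∀ r, 0 ≤ C r) (hA : 0 ≤ A)
    (hC_top : Tendsto (fun x : ℝ => C ‖x‖₊) (cocompact ℝ) atTop) :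
    IsCompact (feasible C A) := by
  rw [← (isClosed_feasible hC hC0 hA).closure_eq]
  refine isCompact_closure_of_isTightMeasureSet ?_
  rw [isTightMeasureSet_iff_exists_isCompact_measure_compl_le]
  intro ε hε
  obtain ⟨T, hT0, hT⟩ : ∃ T : ℝ, 0 < T ∧ ENNReal.ofReal A / ENNReal.ofReal T ≤ ε := by
    obtain ⟨δ, hδ0, hδ⟩ := ENNReal.lt_iff_exists_nnreal_btwn.1 hε
    have hδ0' : (0 : ℝ) < δ := by exact_mod_cast hδ0
    refine ⟨A / δ + 1, by positivity, le_trans ?_ hδ.le⟩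
    rw [← ENNReal.ofReal_div_of_pos (by positivity), ← ENNReal.ofReal_coe_nnreal]
    refine ENNReal.ofReal_le_ofReal ?_
    rw [div_le_iff₀ (by positivity)]
    have : (δ : ℝ) * (A / δ + 1) = A + δ := by field_simp
    linarith
  obtain ⟨K, hK, hKT⟩ := mem_cocompact.1 (hC_top.eventually_ge_atTop T)
  refine ⟨K, hK, ?_⟩
  rintro μ ⟨F, hF, rfl⟩
  have hm : Measurable fun x : ℝ => ENNReal.ofReal (C ‖x‖₊) :=
    (lowerSemicontinuous_cost hC).measurable.ennreal_ofReal
  calc (F : Measure ℝ) Kᶜ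
      ≤ (F : Measure ℝ) {x | ENNReal.ofReal T ≤ ENNReal.ofReal (C ‖x‖₊)} :=
        measure_mono fun x hx => ENNReal.ofReal_le_ofReal (hKT hx)
    _ ≤ (∫⁻ x : ℝ, ENNReal.ofReal (C ‖x‖₊) ∂(F : Measure ℝ)) / ENNReal.ofReal T :=
        meas_ge_le_lintegral_div hm.aemeasurable (by simpa using hT0) ENNReal.ofReal_ne_top
    _ ≤ ENNReal.ofReal A / ENNReal.ofReal T :=
        ENNReal.div_le_div_right ((mem_feasible_iff hC hC0 hA F).1 hF) _
    _ ≤ ε := hT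

end Feasible

/-! ### The Cauchy-type reference density -/

lemma one_add_sq_add_le (s t : ℝ) : 1 + (s + t) ^ 2 ≤ 2 * (1 + s ^ 2) * (1 + t ^ 2) := by
  nlinarith [sq_nonneg (s - t), mul_nonneg (sq_nonneg s) (sq_nonneg t)]

lemma log_one_add_sq_add_le (s t : ℝ) :
    Real.log (1 + (s + t) ^ 2)
      ≤ Real.log 2 + Real.log (1 + s ^ 2) + Real.log (1 + t ^ 2) := by
  rw [← Real.log_mul (by positivity) (by positivity),
    ← Real.log_mul (by positivity) (by positivity)]
  exact Real.log_le_log (by positivity) (one_add_sq_add_le s t)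

lemma log_one_add_sq_le {t : ℝ} (ht : 1 ≤ |t|) :
    Real.log (1 + t ^ 2) ≤ Real.log 2 + 2 * Real.log |t| := by
  have h1 : (1 : ℝ) ≤ |t| ^ 2 := one_le_pow₀ ht
  have h2 : (2 : ℝ) * Real.log |t| = Real.log (|t| ^ 2) := by rw [Real.log_pow]; norm_num
  rw [h2, ← Real.log_mul (by norm_num) (by positivity)]
  refine Real.log_le_log (by positivity) ?_
  rw [sq_abs] at *
  linarith

lemma log_one_add_sq_nonneg (t : ℝ) : 0 ≤ Real.log (1 + t ^ 2) :=
  Real.log_nonneg (by nlinarith [sq_nonneg t])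

lemma continuous_log_one_add_sq : Continuous fun t : ℝ => Real.log (1 + t ^ 2) :=
  Continuous.log (by fun_prop) fun t => by positivity

/-- If `log |f|` is negligible with respect to `c` at infinity, then so is `log (1 + f²)`, up to an
additive constant. -/
lemma exists_log_one_add_sq_le_add_mul {f c : ℝ → ℝ} (hf : Continuous f)
    (hf_lim : Tendsto (fun x => |f x|) (cocompact ℝ) atTop)
    (hc : (fun x : ℝ => Real.log |f x|) =o[cocompact ℝ] c) {ε : ℝ} (hε : 0 < ε) :
    ∃ B : ℝ, 0 ≤ B ∧ ∀ x, Real.log (1 + f x ^ 2) ≤ B + ε * |c x| := by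
  have hev : ∀ᶠ x in cocompact ℝ, Real.log (1 + f x ^ 2) ≤ Real.log 2 + ε * |c x| := by
    filter_upwards [hf_lim.eventually_ge_atTop 1, hc.bound (half_pos hε)] with x h1 h2
    rw [Real.norm_eq_abs, Real.norm_eq_abs] at h2
    have h3 := log_one_add_sq_le h1
    have h4 := le_abs_self (Real.log |f x|)
    linarith
  obtain ⟨K, hK, hKs⟩ := mem_cocompact.1 hev
  obtain ⟨B, hB⟩ := hK.exists_bound_of_continuousOn
    (continuous_log_one_add_sq.comp hf).continuousOn
  have hlog2 : 0 ≤ Real.log 2 := Real.log_nonneg (by norm_num)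
  refine ⟨Real.log 2 + |B|, by positivity, fun x => ?_⟩
  have h0 : 0 ≤ ε * |c x| := by positivity
  by_cases hx : x ∈ K
  · have h1 := (le_abs_self _).trans ((hB x hx).trans (le_abs_self B))
    simp only [Function.comp] at h1
    linarith
  · have h1 : Real.log (1 + f x ^ 2) ≤ Real.log 2 + ε * |c x| := hKs hx
    linarith [abs_nonneg B]

/-- The super-logarithmic moment of the noise makes its logarithmic moment finite. -/
lemma integrable_mul_log_one_add_sq {p : ℝ → ℝ} (hp : IsNoiseDensity p) {c : ℝ → ℝ}
    (hc : (fun x : ℝ => Real.log |x|) =o[cocompact ℝ] c) (hint : Integrable c (noiseLaw p)) :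
    Integrable fun n => p n * Real.log (1 + n ^ 2) := by
  have := isProbabilityMeasure_noiseLaw hp
  obtain ⟨B, -, hB⟩ := exists_log_one_add_sq_le_add_mul continuous_id
    (tendsto_norm_cocompact_atTop (E := ℝ)) hc one_pos
  have h : Integrable (fun n : ℝ => Real.log (1 + n ^ 2)) (noiseLaw p) := by
    refine Integrable.mono' (g := fun n => B + 1 * |c n|)
      ((integrable_const B).add (hint.abs.const_mul 1))
      continuous_log_one_add_sq.aestronglyMeasurable (ae_of_all _ fun n => ?_)
    rw [Real.norm_of_nonneg (log_one_add_sq_nonneg n)]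
    exact hB n
  rw [noiseLaw, integrable_withDensity_iff_integrable_smul'
    hp.continuous.measurable.ennreal_ofReal (ae_of_all _ fun _ => ENNReal.ofReal_lt_top)] at h
  refine h.congr (ae_of_all _ fun n => ?_)
  simp only [ENNReal.toReal_ofReal (hp.pos n).le, smul_eq_mul]

section CondDiv

variable {f p q : ℝ → ℝ}

lemma condDiv_eq_lintegral_add (f p q : ℝ → ℝ) (x : ℝ) :
    condDiv f p q x = ∫⁻ n, ENNReal.ofReal (relEnt (p n) (q (f x + n))) := by
  rw [condDiv, ← lintegral_add_left_eq_self _ (f x)]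
  simp

lemma condDiv_le_ofReal_integral {x : ℝ} {b : ℝ → ℝ} (hb : Integrable b) (hb0 : ∀ n, 0 ≤ b n)
    (h : ∀ n, relEnt (p n) (q (f x + n)) ≤ b n) :
    condDiv f p q x ≤ ENNReal.ofReal (∫ n, b n) := by
  rw [condDiv_eq_lintegral_add, ofReal_integral_eq_lintegral_ofReal hb (ae_of_all _ hb0)]
  exact lintegral_mono fun n => ENNReal.ofReal_le_ofReal (h n)

lemma IsNoiseDensity.exists_one_le_bound (hp : IsNoiseDensity p) :
    ∃ M : ℝ, 1 ≤ M ∧ ∀ x, p x ≤ M := by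
  obtain ⟨M, hM⟩ := hp.bdd
  exact ⟨max 1 M, le_max_left _ _, fun x => (hM x).trans (le_max_right _ _)⟩

/-- A bound on the relative entropy integrand that is linear in the noise density. -/
lemma relEnt_le {a b M : ℝ} (ha : 0 < a) (haM : a ≤ M) :
    relEnt a b ≤ a * (Real.log M - Real.log b) + b := by
  have := mul_le_mul_of_nonneg_left (Real.log_le_log ha haM) ha.le
  rw [relEnt]
  linarith

/-- The Cauchy-type reference density `1 / (1 + y²)`, of total mass `π`. -/
noncomputable def cauchyRef (y : ℝ) : ℝ := (1 + y ^ 2)⁻¹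

lemma cauchyRef_pos (y : ℝ) : 0 < cauchyRef y := by unfold cauchyRef; positivity

lemma continuous_cauchyRef : Continuous cauchyRef :=
  Continuous.inv₀ (by fun_prop) fun y => by positivity

lemma log_cauchyRef (y : ℝ) : Real.log (cauchyRef y) = -Real.log (1 + y ^ 2) := Real.log_inv _

lemma relEnt_cauchyRef_le (hp : IsNoiseDensity p) {M : ℝ} (hM : ∀ x, p x ≤ M) (s n : ℝ) :
    relEnt (p n) (cauchyRef (s + n)) ≤ p n * (Real.log M + Real.log 2 + Real.log (1 + s ^ 2))
      + p n * Real.log (1 + n ^ 2) + cauchyRef (s + n) := by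
  refine (relEnt_le (hp.pos n) (hM n)).trans ?_
  rw [log_cauchyRef]
  have := mul_le_mul_of_nonneg_left (log_one_add_sq_add_le s n) (hp.pos n).le
  linarith

lemma exists_condDiv_cauchyRef_le (hp : IsNoiseDensity p)
    (hlog : Integrable fun n => p n * Real.log (1 + n ^ 2)) (f : ℝ → ℝ) :
    ∃ c : ℝ, 0 ≤ c ∧ ∀ x,
      condDiv f p cauchyRef x ≤ ENNReal.ofReal (c + Real.log (1 + f x ^ 2)) := by
  obtain ⟨M, hM1, hM⟩ := hp.exists_one_le_bound
  have hlogM : 0 ≤ Real.log M := Real.log_nonneg hM1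
  have hlog2 : 0 ≤ Real.log 2 := Real.log_nonneg (by norm_num)
  have hE : 0 ≤ ∫ n, p n * Real.log (1 + n ^ 2) :=
    integral_nonneg fun n => mul_nonneg (hp.pos n).le (log_one_add_sq_nonneg n)
  refine ⟨Real.log M + Real.log 2 + (∫ n, p n * Real.log (1 + n ^ 2)) + Real.pi,
    by positivity, fun x => ?_⟩
  set s := f x with hs
  have hls := log_one_add_sq_nonneg s
  have hi1 : Integrable fun n => p n * (Real.log M + Real.log 2 + Real.log (1 + s ^ 2)) :=
    hp.integrable.mul_const _
  have hi2 : Integrable fun n => cauchyRef (s + n) :=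
    integrable_inv_one_add_sq.comp_add_left s
  have hpi : ∫ n, cauchyRef (s + n) = Real.pi := by
    rw [integral_add_left_eq_self cauchyRef s]
    exact integral_univ_inv_one_add_sq
  refine (condDiv_le_ofReal_integral ((hi1.add hlog).add hi2) (fun n => ?_)
    fun n => relEnt_cauchyRef_le hp hM s n).trans (ENNReal.ofReal_le_ofReal (le_of_eq ?_))
  · have h1 := hp.pos n
    have h2 := log_one_add_sq_nonneg n
    have h3 := cauchyRef_pos (s + n)
    simp only [Pi.add_apply]
    positivity
  · rw [integral_add' (hi1.add hlog) hi2, integral_add' hi1 hlog, integral_mul_const,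
      hp.integral_eq_one, hpi]
    ring

/-- The divergence from the Cauchy-type reference depends continuously on the input, by dominated
convergence. -/
lemma continuous_condDiv_cauchyRef (hp : IsNoiseDensity p) (hf : Continuous f)
    (hlog : Integrable fun n => p n * Real.log (1 + n ^ 2)) :
    Continuous (condDiv f p cauchyRef) := by
  obtain ⟨M, hM1, hM⟩ := hp.exists_one_le_bound
  rw [continuous_iff_continuousAt]
  intro x₀
  have hfun : condDiv f p cauchyRef
      = fun x => ∫⁻ n, ENNReal.ofReal (relEnt (p n) (cauchyRef (f x + n))) :=
    funext fun x => condDiv_eq_lintegral_add f p cauchyRef x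
  rw [hfun]
  set B : ℝ := 1 + f x₀ ^ 2 with hB
  set b : ℝ → ℝ := fun n => p n * (Real.log M + Real.log 2 + Real.log (1 + B))
      + p n * Real.log (1 + n ^ 2) + 2 * (1 + B) * cauchyRef n with hb
  have hbint : Integrable b :=
    ((hp.integrable.mul_const _).add hlog).add (integrable_inv_one_add_sq.const_mul _)
  have hev : ∀ᶠ x in nhds x₀, f x ^ 2 ≤ B :=
    ((hf.pow 2).continuousAt.eventually_lt continuousAt_const (by simp [hB])).mono
      fun x hx => le_of_lt hx
  refine tendsto_lintegral_filter_of_dominated_convergence (fun n => ENNReal.ofReal (b n))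
    (Eventually.of_forall fun x => ?_) (hev.mono fun x hx => ae_of_all _ fun n => ?_) ?_
    (ae_of_all _ fun n => ?_)
  · exact (hp.continuous.measurable.relEnt
      (continuous_cauchyRef.measurable.comp (measurable_const_add _))).ennreal_ofReal
  · refine ENNReal.ofReal_le_ofReal ((relEnt_cauchyRef_le hp hM _ n).trans ?_)
    have h1 : Real.log (1 + f x ^ 2) ≤ Real.log (1 + B) :=
      Real.log_le_log (by positivity) (by linarith)
    have h2 : cauchyRef (f x + n) ≤ 2 * (1 + B) * cauchyRef n := by
      have h := one_add_sq_add_le (f x + n) (-f x)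
      have h' : f x + n + -f x = n := by ring
      rw [h', neg_sq] at h
      have hn : (0 : ℝ) < 1 + n ^ 2 := by positivity
      have hm : (0 : ℝ) < 1 + (f x + n) ^ 2 := by positivity
      unfold cauchyRef
      rw [← div_eq_mul_inv, inv_eq_one_div, div_le_div_iff₀ hm hn]
      have := mul_le_mul_of_nonneg_left (add_le_add_right hx 1) hm.le
      nlinarith
    have h3 := mul_le_mul_of_nonneg_left h1 (hp.pos n).le
    simp only [hb]
    linarith
  · exact hbint.lintegral_lt_top.ne
  · refine ENNReal.tendsto_ofReal (tendsto_const_nhds.relEnt ?_ (cauchyRef_pos _).ne')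
    exact (continuous_cauchyRef.comp (hf.add continuous_const)).tendsto x₀

end CondDiv

/-! ### Finite capacity and existence of an optimal input -/

lemma ENNReal.liminf_add_liminf_le (u v : ℕ → ℝ≥0∞) :
    liminf u atTop + liminf v atTop ≤ liminf (fun n => u n + v n) atTop := by
  simp only [liminf_eq_iSup_iInf_of_nat]
  rw [ENNReal.iSup_add_iSup_of_monotone]
  · refine iSup_mono fun n => le_iInf₂ fun i hi => ?_
    exact add_le_add (iInf₂_le i hi) (iInf₂_le i hi)
  · exact fun m n hmn => le_iInf₂ fun i hi => iInf₂_le i (hmn.trans hi)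
  · exact fun m n hmn => le_iInf₂ fun i hi => iInf₂_le i (hmn.trans hi)

section Existence

variable {f p : ℝ → ℝ} {C : ℝ≥0 → ℝ} {A : ℝ}

/-- A bound by the cost turns the feasibility constraint into a bound on the mean. -/
lemma lintegral_le_of_le_cost (hC : LowerSemicontinuous C) (hC0 : ∀ r, 0 ≤ C r) (hA : 0 ≤ A)
    {F : ProbabilityMeasure ℝ} (hF : F ∈ feasible C A) {g : ℝ → ℝ≥0∞} {B ε : ℝ} (hB : 0 ≤ B)
    (hε : 0 ≤ ε) (hg : ∀ x, g x ≤ ENNReal.ofReal (B + ε * C ‖x‖₊)) :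
    ∫⁻ x, g x ∂(F : Measure ℝ) ≤ ENNReal.ofReal B + ENNReal.ofReal ε * ENNReal.ofReal A := by
  have hm : Measurable fun x : ℝ => ENNReal.ofReal (C ‖x‖₊) :=
    (lowerSemicontinuous_cost hC).measurable.ennreal_ofReal
  calc ∫⁻ x, g x ∂(F : Measure ℝ)
      ≤ ∫⁻ x : ℝ, (ENNReal.ofReal B + ENNReal.ofReal ε * ENNReal.ofReal (C ‖x‖₊))
          ∂(F : Measure ℝ) := by
        refine lintegral_mono fun x => (hg x).trans_eq ?_
        rw [ENNReal.ofReal_add hB (mul_nonneg hε (hC0 _)), ENNReal.ofReal_mul hε]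
    _ = ENNReal.ofReal B
          + ENNReal.ofReal ε * ∫⁻ x : ℝ, ENNReal.ofReal (C ‖x‖₊) ∂(F : Measure ℝ) := by
        rw [lintegral_add_left measurable_const, lintegral_const_mul _ hm]
        simp
    _ ≤ _ := by gcongr; exact (mem_feasible_iff hC hC0 hA F).1 hF

/-- Along a weakly convergent sequence of feasible laws, the means of a continuous function that is
negligible with respect to the cost are upper semicontinuous: `B + ε C - g` is nonnegative and
lower semicontinuous for every `ε`, so the portmanteau inequality applies to it. -/
lemma liminf_lintegral_le_of_le_cost (hC : LowerSemicontinuous C) (hC0 : ∀ r, 0 ≤ C r)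
    (hA : 0 ≤ A) {g : ℝ → ℝ≥0∞} (hg : Continuous g)
    (hgC : ∀ ε > 0, ∃ B : ℝ, 0 ≤ B ∧ ∀ x : ℝ, g x ≤ ENNReal.ofReal (B + ε * C ‖x‖₊))
    {F : ProbabilityMeasure ℝ} {Fs : ℕ → ProbabilityMeasure ℝ} (hFs : ∀ n, Fs n ∈ feasible C A)
    (hlim : Tendsto Fs atTop (nhds F)) :
    liminf (fun n => ∫⁻ x, g x ∂(Fs n : Measure ℝ)) atTop ≤ ∫⁻ x, g x ∂(F : Measure ℝ) := by
  have hF : F ∈ feasible C A :=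
    (isClosed_feasible hC hC0 hA).mem_of_tendsto hlim (Eventually.of_forall hFs)
  have hg_top : ∀ x, g x ≠ ∞ := fun x => by
    obtain ⟨B, -, hB⟩ := hgC 1 one_pos
    exact ((hB x).trans_lt ENNReal.ofReal_lt_top).ne
  refine ENNReal.le_of_forall_pos_le_add fun δ hδ _ => ?_
  set ε : ℝ := δ / (A + 1) with hε_def
  have hδ' : (0 : ℝ) < δ := by exact_mod_cast hδ
  have hε : 0 < ε := by positivity
  have hεA : ENNReal.ofReal ε * ENNReal.ofReal A ≤ δ := by
    rw [← ENNReal.ofReal_mul hε.le, ← ENNReal.ofReal_coe_nnreal]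
    refine ENNReal.ofReal_le_ofReal ?_
    rw [hε_def, div_mul_eq_mul_div, div_le_iff₀ (by positivity)]
    nlinarith
  obtain ⟨B, hB0, hB⟩ := hgC ε hε
  set h : ℝ → ℝ := fun x => (B - (g x).toReal) + ε * C ‖x‖₊ with hh
  have hle : ∀ x : ℝ, (g x).toReal ≤ B + ε * C ‖x‖₊ := fun x =>
    ENNReal.toReal_le_of_le_ofReal
      (add_nonneg hB0 (mul_nonneg hε.le (hC0 _))) (hB x)
  have hh0 : 0 ≤ h := fun x => by
    have := hle x
    simp only [hh, Pi.zero_apply]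
    linarith
  have hlsc : LowerSemicontinuous h := by
    refine LowerSemicontinuous.add (Continuous.lowerSemicontinuous ?_) ?_
    · exact continuous_const.sub
        (continuous_iff_continuousAt.2 fun x =>
          (ENNReal.tendsto_toReal (hg_top x)).comp hg.continuousAt)
    · exact (continuous_const_mul ε).comp_lowerSemicontinuous (lowerSemicontinuous_cost hC)
        fun a b hab => mul_le_mul_of_nonneg_left hab hε.le
  have hsum : ∀ x : ℝ, ENNReal.ofReal (h x) + g x = ENNReal.ofReal (B + ε * C ‖x‖₊) := fun x => by
    conv_lhs => rw [← ENNReal.ofReal_toReal (hg_top x)]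
    rw [← ENNReal.ofReal_add (hh0 x) ENNReal.toReal_nonneg]
    congr 1
    simp only [hh]
    ring
  have hsum' : ∀ G : ProbabilityMeasure ℝ,
      ∫⁻ x, ENNReal.ofReal (h x) ∂(G : Measure ℝ) + ∫⁻ x, g x ∂(G : Measure ℝ)
        = ∫⁻ x : ℝ, ENNReal.ofReal (B + ε * C ‖x‖₊) ∂(G : Measure ℝ) := fun G => by
    rw [← lintegral_add_right _ hg.measurable]
    exact lintegral_congr hsum
  have hupper : ∀ G ∈ feasible C A,
      ∫⁻ x, ENNReal.ofReal (h x) ∂(G : Measure ℝ) + ∫⁻ x, g x ∂(G : Measure ℝ)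
        ≤ ENNReal.ofReal B + δ := fun G hG => by
    rw [hsum' G]
    exact (lintegral_le_of_le_cost hC hC0 hA hG hB0 hε.le fun x => le_rfl).trans (by gcongr)
  have hlower : ENNReal.ofReal B
      ≤ ∫⁻ x, ENNReal.ofReal (h x) ∂(F : Measure ℝ) + ∫⁻ x, g x ∂(F : Measure ℝ) := by
    rw [hsum' F]
    calc ENNReal.ofReal B = ∫⁻ _ : ℝ, ENNReal.ofReal B ∂(F : Measure ℝ) := by simp
      _ ≤ _ := lintegral_mono fun x => ENNReal.ofReal_le_ofReal
        (le_add_of_nonneg_right (mul_nonneg hε.le (hC0 _)))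
  have hfin : ∫⁻ x, ENNReal.ofReal (h x) ∂(F : Measure ℝ) ≠ ∞ :=
    ((le_self_add.trans (hupper F hF)).trans_lt (by simp)).ne
  refine (ENNReal.add_le_add_iff_left hfin).1 ?_
  calc ∫⁻ x, ENNReal.ofReal (h x) ∂(F : Measure ℝ)
        + liminf (fun n => ∫⁻ x, g x ∂(Fs n : Measure ℝ)) atTop
      ≤ liminf (fun n => ∫⁻ x, ENNReal.ofReal (h x) ∂(Fs n : Measure ℝ)) atTop
        + liminf (fun n => ∫⁻ x, g x ∂(Fs n : Measure ℝ)) atTop := by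
        gcongr
        exact hlsc.lintegral_le_liminf hh0 hlim
    _ ≤ liminf (fun n => ∫⁻ x, ENNReal.ofReal (h x) ∂(Fs n : Measure ℝ)
          + ∫⁻ x, g x ∂(Fs n : Measure ℝ)) atTop := ENNReal.liminf_add_liminf_le _ _
    _ ≤ ENNReal.ofReal B + δ :=
        liminf_le_of_frequently_le' (Frequently.of_forall fun n => hupper _ (hFs n))
    _ ≤ (∫⁻ x, ENNReal.ofReal (h x) ∂(F : Measure ℝ) + ∫⁻ x, g x ∂(F : Measure ℝ)) + δ := by
        gcongr
    _ = _ := add_assoc _ _ _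

lemma tendsto_outputDensity (hp : IsNoiseDensity p) (hf : Continuous f)
    {F : ProbabilityMeasure ℝ} {Fs : ℕ → ProbabilityMeasure ℝ}
    (hlim : Tendsto Fs atTop (nhds F)) (y : ℝ) :
    Tendsto (fun n => outputDensity f p (Fs n : Measure ℝ) y) atTop
      (nhds (outputDensity f p (F : Measure ℝ) y)) := by
  obtain ⟨M, hM⟩ := hp.bdd
  exact (ProbabilityMeasure.tendsto_iff_forall_integral_tendsto.1 hlim)
    (BoundedContinuousFunction.ofNormedAddCommGroup (fun x => p (y - f x))
      (hp.continuous.comp (continuous_const.sub hf)) M fun x => by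
        rw [Real.norm_of_nonneg (hp.pos _).le]
        exact hM _)

lemma liminf_mutualInfo_le (hp : IsNoiseDensity p) (hf : Continuous f)
    (hC : LowerSemicontinuous C) (hC0 : ∀ r, 0 ≤ C r) (hA : 0 ≤ A) {q : ℝ → ℝ}
    (hq : Measurable q) (hqpos : ∀ y, 0 < q y) (hΦ : Continuous (condDiv f p q))
    (hΦC : ∀ ε > 0, ∃ B : ℝ, 0 ≤ B ∧ ∀ x : ℝ,
      condDiv f p q x ≤ ENNReal.ofReal (B + ε * C ‖x‖₊))
    {F : ProbabilityMeasure ℝ} {Fs : ℕ → ProbabilityMeasure ℝ} (hFs : ∀ n, Fs n ∈ feasible C A)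
    (hlim : Tendsto Fs atTop (nhds F)) :
    liminf (fun n => mutualInfo f p (Fs n : Measure ℝ)) atTop
      ≤ mutualInfo f p (F : Measure ℝ) := by
  have hF : F ∈ feasible C A :=
    (isClosed_feasible hC hC0 hA).mem_of_tendsto hlim (Eventually.of_forall hFs)
  have hcomp := fun G : ProbabilityMeasure ℝ =>
    lintegral_condDiv_eq_mutualInfo_add (G : Measure ℝ) hp hf.measurable hq hqpos
  have hD : ∫⁻ y, ENNReal.ofReal (relEnt (outputDensity f p (F : Measure ℝ) y) (q y)) ≠ ∞ := by
    obtain ⟨B, hB0, hB⟩ := hΦC 1 one_pos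
    have h := lintegral_le_of_le_cost hC hC0 hA hF hB0 zero_le_one hB
    rw [hcomp F] at h
    exact ((le_add_self.trans h).trans_lt
      (ENNReal.add_lt_top.2 ⟨ENNReal.ofReal_lt_top,
        ENNReal.mul_lt_top ENNReal.ofReal_lt_top ENNReal.ofReal_lt_top⟩)).ne
  have hfatou : ∫⁻ y, ENNReal.ofReal (relEnt (outputDensity f p (F : Measure ℝ) y) (q y))
      ≤ liminf (fun n => ∫⁻ y,
        ENNReal.ofReal (relEnt (outputDensity f p (Fs n : Measure ℝ) y) (q y))) atTop := by
    refine le_trans (le_of_eq (lintegral_congr fun y => ?_)) (lintegral_liminf_le fun n =>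
      ((measurable_outputDensity (Fs n : Measure ℝ) hp hf.measurable).relEnt hq).ennreal_ofReal)
    exact (ENNReal.tendsto_ofReal ((tendsto_outputDensity hp hf hlim y).relEnt
      tendsto_const_nhds (hqpos y).ne')).liminf_eq.symm
  refine (ENNReal.add_le_add_iff_right hD).1 ?_
  rw [← hcomp F]
  refine le_trans ?_ (liminf_lintegral_le_of_le_cost hC hC0 hA hΦ hΦC hFs hlim)
  simp_rw [hcomp]
  exact (add_le_add le_rfl hfatou).trans (ENNReal.liminf_add_liminf_le _ _)

lemma dirac_zero_mem_feasible (hC_zero : C 0 = 0) (hA : 0 ≤ A) :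
    (⟨Measure.dirac 0, inferInstance⟩ : ProbabilityMeasure ℝ) ∈ feasible C A := by
  constructor
  · exact integrable_dirac (by simp)
  · simpa [hC_zero] using hA

lemma mutualInfo_le_capacity {F : ProbabilityMeasure ℝ} (hF : F ∈ feasible C A) :
    mutualInfo f p (F : Measure ℝ) ≤ capacity f p C A :=
  le_iSup₂ (f := fun (F : ProbabilityMeasure ℝ) (_ : F ∈ feasible C A) =>
    mutualInfo f p (F : Measure ℝ)) F hF

lemma capacity_lt_top (hp : IsNoiseDensity p) (hf : Continuous f)
    (hC : LowerSemicontinuous C) (hC0 : ∀ r, 0 ≤ C r) (hA : 0 ≤ A) {q : ℝ → ℝ}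
    (hq : Measurable q) (hqpos : ∀ y, 0 < q y)
    (hΦC : ∃ B : ℝ, 0 ≤ B ∧ ∀ x : ℝ, condDiv f p q x ≤ ENNReal.ofReal (B + 1 * C ‖x‖₊)) :
    capacity f p C A < ∞ := by
  obtain ⟨B, hB0, hB⟩ := hΦC
  have hfin : ENNReal.ofReal B + ENNReal.ofReal 1 * ENNReal.ofReal A < ∞ :=
    ENNReal.add_lt_top.2 ⟨ENNReal.ofReal_lt_top,
      ENNReal.mul_lt_top ENNReal.ofReal_lt_top ENNReal.ofReal_lt_top⟩
  refine lt_of_le_of_lt (iSup₂_le fun F hF => ?_) hfin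
  have h := lintegral_le_of_le_cost hC hC0 hA hF hB0 zero_le_one hB
  rw [lintegral_condDiv_eq_mutualInfo_add (F : Measure ℝ) hp hf.measurable hq hqpos] at h
  exact le_self_add.trans h

/-- An upper semicontinuous function attains its supremum on the compact feasible set. -/
lemma exists_isCapacityAchieving (hp : IsNoiseDensity p) (hf : Continuous f)
    (hC : LowerSemicontinuous C) (hC0 : ∀ r, 0 ≤ C r) (hC_zero : C 0 = 0) (hA : 0 ≤ A)
    (hC_top : Tendsto (fun x : ℝ => C ‖x‖₊) (cocompact ℝ) atTop) {q : ℝ → ℝ}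
    (hq : Measurable q) (hqpos : ∀ y, 0 < q y) (hΦ : Continuous (condDiv f p q))
    (hΦC : ∀ ε > 0, ∃ B : ℝ, 0 ≤ B ∧ ∀ x : ℝ,
      condDiv f p q x ≤ ENNReal.ofReal (B + ε * C ‖x‖₊)) :
    ∃ F : ProbabilityMeasure ℝ, IsCapacityAchieving f p C A F := by
  obtain ⟨u, -, hu, hmem⟩ := exists_seq_tendsto_sSup
    (S := (fun F : ProbabilityMeasure ℝ => mutualInfo f p (F : Measure ℝ)) '' feasible C A)
    (Set.Nonempty.image _ ⟨_, dirac_zero_mem_feasible hC_zero hA⟩) (OrderTop.bddAbove _)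
  choose Fs hFs hFu using hmem
  obtain ⟨F, hF, φ, hφ, hlim⟩ := (isCompact_feasible hC hC0 hA hC_top).tendsto_subseq hFs
  refine ⟨F, hF, le_antisymm (mutualInfo_le_capacity hF) ?_⟩
  have h := liminf_mutualInfo_le hp hf hC hC0 hA hq hqpos hΦ hΦC (fun n => hFs (φ n)) hlim
  have hcap : Tendsto (fun n => mutualInfo f p (Fs (φ n) : Measure ℝ)) atTop
      (nhds (capacity f p C A)) := by
    rw [capacity, ← sSup_image]
    refine (hu.comp hφ.tendsto_atTop).congr fun n => (hFu _).symm
  exact hcap.liminf_eq.ge.trans h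

end Existence

/-! ### Optimality conditions -/

section Optimality

variable {f p : ℝ → ℝ} {C : ℝ≥0 → ℝ} {A : ℝ}

lemma exists_probabilityMeasure_mixture {Ω : Type*} [MeasurableSpace Ω]
    (F G : ProbabilityMeasure Ω) {θ : ℝ} (h0 : 0 ≤ θ) (h1 : θ ≤ 1) :
    ∃ H : ProbabilityMeasure Ω, (H : Measure Ω)
      = ENNReal.ofReal (1 - θ) • (F : Measure Ω) + ENNReal.ofReal θ • (G : Measure Ω) := by
  refine ⟨⟨_, ⟨?_⟩⟩, rfl⟩
  simp only [Measure.coe_add, Measure.coe_smul, Pi.add_apply, Pi.smul_apply, measure_univ,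
    smul_eq_mul, mul_one]
  rw [← ENNReal.ofReal_add (by linarith) h0]
  simp

lemma outputDensity_mixture (hp : IsNoiseDensity p) (hf : Measurable f)
    {F G H : ProbabilityMeasure ℝ} {θ : ℝ} (h0 : 0 ≤ θ) (h1 : θ ≤ 1) (hH : (H : Measure ℝ)
      = ENNReal.ofReal (1 - θ) • (F : Measure ℝ) + ENNReal.ofReal θ • (G : Measure ℝ)) (y : ℝ) :
    outputDensity f p (H : Measure ℝ) y
      = (1 - θ) * outputDensity f p (F : Measure ℝ) y
        + θ * outputDensity f p (G : Measure ℝ) y := by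
  rw [outputDensity, hH, integral_add_measure
    ((hp.integrable_comp _ hf y).smul_measure ENNReal.ofReal_ne_top)
    ((hp.integrable_comp _ hf y).smul_measure ENNReal.ofReal_ne_top),
    integral_smul_measure, integral_smul_measure, ENNReal.toReal_ofReal h0,
    ENNReal.toReal_ofReal (by linarith)]
  rfl

lemma mixture_mem_feasible (hC : LowerSemicontinuous C) (hC0 : ∀ r, 0 ≤ C r) (hA : 0 ≤ A)
    {F G H : ProbabilityMeasure ℝ} (hF : F ∈ feasible C A) (hG : G ∈ feasible C A)
    {θ : ℝ} (h0 : 0 ≤ θ) (h1 : θ ≤ 1) (hH : (H : Measure ℝ)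
      = ENNReal.ofReal (1 - θ) • (F : Measure ℝ) + ENNReal.ofReal θ • (G : Measure ℝ)) :
    H ∈ feasible C A := by
  rw [mem_feasible_iff hC hC0 hA] at *
  rw [hH, lintegral_add_measure, lintegral_smul_measure, lintegral_smul_measure]
  calc _ ≤ ENNReal.ofReal (1 - θ) • ENNReal.ofReal A + ENNReal.ofReal θ • ENNReal.ofReal A := by
        gcongr
    _ = ENNReal.ofReal A := by
        rw [← add_smul, ← ENNReal.ofReal_add (by linarith) h0]
        simp

/-- First-order optimality: with the output law of an optimal input as reference, the mean
divergence of no feasible input exceeds the capacity. Optimality against the mixtures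
`(1 - θ) F + θ G` and the compensation identity give this with the output law of the mixture as
reference, and Fatou's lemma lets `θ → 0`. -/
theorem lintegral_condDiv_le_capacity (hp : IsNoiseDensity p) (hf : Measurable f)
    (hC : LowerSemicontinuous C) (hC0 : ∀ r, 0 ≤ C r) (hA : 0 ≤ A)
    (hcap : capacity f p C A < ∞) {F G : ProbabilityMeasure ℝ}
    (hF : IsCapacityAchieving f p C A F) (hG : G ∈ feasible C A) :
    ∫⁻ x, condDiv f p (outputDensity f p (F : Measure ℝ)) x ∂(G : Measure ℝ)
      ≤ capacity f p C A := by
  have hθ : ∀ n : ℕ, 0 < 1 / ((n : ℝ) + 1) ∧ 1 / ((n : ℝ) + 1) ≤ 1 := fun n =>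
    ⟨by positivity, by rw [div_le_one (by positivity)]; linarith [n.cast_nonneg (α := ℝ)]⟩
  choose H hH using fun n : ℕ => exists_probabilityMeasure_mixture F G (hθ n).1.le (hθ n).2
  refine (lintegral_condDiv_le_liminf (G : Measure ℝ) hp hf
    (outputDensity_pos (F : Measure ℝ) hp hf)
    (fun n => measurable_outputDensity (H n : Measure ℝ) hp hf) fun y => ?_).trans
    (liminf_le_of_frequently_le' (Frequently.of_forall fun n => ?_))
  · have h : Tendsto (fun n : ℕ => (1 - 1 / ((n : ℝ) + 1)) * outputDensity f p (F : Measure ℝ) y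
        + 1 / ((n : ℝ) + 1) * outputDensity f p (G : Measure ℝ) y) atTop
        (nhds ((1 - 0) * outputDensity f p (F : Measure ℝ) y
          + 0 * outputDensity f p (G : Measure ℝ) y)) := by
      have h0 := tendsto_one_div_add_atTop_nhds_zero_nat (𝕜 := ℝ)
      exact ((tendsto_const_nhds.sub h0).mul_const _).add (h0.mul_const _)
    rw [sub_zero, one_mul, zero_mul, add_zero] at h
    exact h.congr fun n => (outputDensity_mixture hp hf (hθ n).1.le (hθ n).2 (hH n) y).symm
  · obtain ⟨h0, h1⟩ := hθ n
    set θ : ℝ := 1 / ((n : ℝ) + 1)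
    set q := outputDensity f p (H n : Measure ℝ)
    have hF' : capacity f p C A ≤ ∫⁻ x, condDiv f p q x ∂(F : Measure ℝ) := by
      rw [← hF.2, lintegral_condDiv_eq_mutualInfo_add (F : Measure ℝ) hp hf
        (measurable_outputDensity (H n : Measure ℝ) hp hf)
        (outputDensity_pos (H n : Measure ℝ) hp hf)]
      exact le_self_add
    have hHn : ENNReal.ofReal (1 - θ) * ∫⁻ x, condDiv f p q x ∂(F : Measure ℝ)
        + ENNReal.ofReal θ * ∫⁻ x, condDiv f p q x ∂(G : Measure ℝ) ≤ capacity f p C A := by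
      refine le_trans (le_of_eq ?_) (mutualInfo_le_capacity
        (mixture_mem_feasible hC hC0 hA hF.1 hG h0.le h1 (hH n)))
      have hmix : ∀ g : ℝ → ℝ≥0∞, ∫⁻ x, g x ∂(H n : Measure ℝ)
          = ENNReal.ofReal (1 - θ) * ∫⁻ x, g x ∂(F : Measure ℝ)
            + ENNReal.ofReal θ * ∫⁻ x, g x ∂(G : Measure ℝ) := fun g => by
        rw [hH n, lintegral_add_measure, lintegral_smul_measure, lintegral_smul_measure]
        rfl
      rw [mutualInfo_eq_lintegral_condDiv _ hp hf, hmix]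
    have hsplit : capacity f p C A = ENNReal.ofReal (1 - θ) * capacity f p C A
        + ENNReal.ofReal θ * capacity f p C A := by
      rw [← add_mul, ← ENNReal.ofReal_add (by linarith) h0.le]
      simp
    have h2 : ENNReal.ofReal (1 - θ) * capacity f p C A
        + ENNReal.ofReal θ * ∫⁻ x, condDiv f p q x ∂(G : Measure ℝ)
        ≤ ENNReal.ofReal (1 - θ) * capacity f p C A
          + ENNReal.ofReal θ * capacity f p C A := by
      rw [← hsplit]
      refine le_trans ?_ hHn
      gcongr
    have h3 := (ENNReal.add_le_add_iff_left
      (ENNReal.mul_lt_top ENNReal.ofReal_lt_top hcap).ne).1 h2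
    exact (ENNReal.mul_le_mul_iff_right (by simpa using h0) ENNReal.ofReal_ne_top).1 h3

/-- The first-order condition tested on laws with two atoms. -/
lemma condDiv_two_point_le_capacity (hp : IsNoiseDensity p) (hf : Measurable f)
    (hC : LowerSemicontinuous C) (hC0 : ∀ r, 0 ≤ C r) (hA : 0 ≤ A)
    (hcap : capacity f p C A < ∞) {F : ProbabilityMeasure ℝ}
    (hF : IsCapacityAchieving f p C A F) {x y θ : ℝ} (h0 : 0 ≤ θ) (h1 : θ ≤ 1)
    (hxy : (1 - θ) * C ‖x‖₊ + θ * C ‖y‖₊ ≤ A) :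
    ENNReal.ofReal (1 - θ) * condDiv f p (outputDensity f p (F : Measure ℝ)) x
      + ENNReal.ofReal θ * condDiv f p (outputDensity f p (F : Measure ℝ)) y
      ≤ capacity f p C A := by
  obtain ⟨G, hG⟩ := exists_probabilityMeasure_mixture
    (⟨Measure.dirac x, inferInstance⟩ : ProbabilityMeasure ℝ) ⟨Measure.dirac y, inferInstance⟩
    h0 h1
  simp only [ProbabilityMeasure.coe_mk] at hG
  have hGf : G ∈ feasible C A := by
    rw [mem_feasible_iff hC hC0 hA, hG, lintegral_add_measure, lintegral_smul_measure,
      lintegral_smul_measure, lintegral_dirac, lintegral_dirac, smul_eq_mul, smul_eq_mul,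
      ← ENNReal.ofReal_mul (by linarith), ← ENNReal.ofReal_mul h0,
      ← ENNReal.ofReal_add (mul_nonneg (by linarith) (hC0 _)) (mul_nonneg h0 (hC0 _))]
    exact ENNReal.ofReal_le_ofReal hxy
  have h := lintegral_condDiv_le_capacity hp hf hC hC0 hA hcap hF hGf
  rwa [hG, lintegral_add_measure, lintegral_smul_measure,
      lintegral_smul_measure, lintegral_dirac, lintegral_dirac, smul_eq_mul, smul_eq_mul] at h

/-- The Lagrange multiplier of a linear program with one constraint, from its two-point tests:
it is the largest slope `(i y - I) / (c y - A)` over the points of cost above `A`, or `0`. -/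
lemma exists_multiplier {α : Type*} {i c : α → ℝ} {A I : ℝ} (hex : ∃ x, c x < A)
    (h : ∀ x y θ, 0 ≤ θ → θ ≤ 1 → (1 - θ) * c x + θ * c y ≤ A → (1 - θ) * i x + θ * i y ≤ I) :
    ∃ ν, 0 ≤ ν ∧ ∀ x, i x ≤ I + ν * (c x - A) := by
  have hle : ∀ x, c x ≤ A → i x ≤ I := fun x hx => by
    simpa using h x x 0 le_rfl zero_le_one (by simpa using hx)
  set S : Set ℝ := {s | s = 0 ∨ ∃ y, A < c y ∧ s = (i y - I) / (c y - A)} with hS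
  have hbound : ∀ x, c x < A → ∀ s ∈ S, s ≤ (I - i x) / (A - c x) := by
    rintro x hx s (rfl | ⟨y, hy, rfl⟩)
    · exact div_nonneg (sub_nonneg.2 (hle x hx.le)) (by linarith)
    · have hd : 0 < c y - c x := by linarith
      -- the weight for which the mean cost of `x` and `y` is exactly `A`
      have h1 := h x y ((A - c x) / (c y - c x)) (div_nonneg (by linarith) hd.le)
        (by rw [div_le_one hd]; linarith) (le_of_eq (by field_simp; ring))
      have h2 : (1 - (A - c x) / (c y - c x)) * i x + (A - c x) / (c y - c x) * i y
          = ((c y - A) * i x + (A - c x) * i y) / (c y - c x) := by field_simp; ring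
      rw [h2, div_le_iff₀ hd] at h1
      rw [div_le_div_iff₀ (by linarith) (by linarith)]
      linarith
  obtain ⟨x₀, hx₀⟩ := hex
  have hbdd : BddAbove S := ⟨_, hbound x₀ hx₀⟩
  refine ⟨sSup S, le_csSup hbdd (Or.inl rfl), fun x => ?_⟩
  rcases lt_trichotomy (c x) A with hx | hx | hx
  · have h1 : sSup S ≤ (I - i x) / (A - c x) := csSup_le ⟨0, Or.inl rfl⟩ (hbound x hx)
    rw [le_div_iff₀ (by linarith)] at h1
    linarith
  · have := hle x hx.le
    simpa [hx] using this
  · have h1 : (i x - I) / (c x - A) ≤ sSup S := le_csSup hbdd (Or.inr ⟨x, hx, rfl⟩)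
    rw [div_le_iff₀ (by linarith)] at h1
    linarith

lemma condDiv_outputDensity_lt_top (hp : IsNoiseDensity p) (hf : Measurable f)
    (hC : LowerSemicontinuous C) (hC0 : ∀ r, 0 ≤ C r) (hC_zero : C 0 = 0) (hA : 0 < A)
    (hcap : capacity f p C A < ∞) {F : ProbabilityMeasure ℝ}
    (hF : IsCapacityAchieving f p C A F) (x : ℝ) :
    condDiv f p (outputDensity f p (F : Measure ℝ)) x < ∞ := by
  have hCx := hC0 ‖x‖₊
  -- an atom of mass `A / (A + C x)` at `x` and the rest at `0` is feasible
  have h := condDiv_two_point_le_capacity hp hf hC hC0 hA.le hcap hF (x := 0) (y := x)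
    (θ := A / (A + C ‖x‖₊)) (by positivity) (by rw [div_le_one (by positivity)]; linarith) (by
      rw [nnnorm_zero, hC_zero, mul_zero, zero_add, div_mul_eq_mul_div, div_le_iff₀ (by positivity)]
      nlinarith)
  have h' := (le_add_self.trans h).trans_lt hcap
  refine ENNReal.lt_top_of_mul_ne_top_right h'.ne ?_
  simp only [ne_eq, ENNReal.ofReal_eq_zero, not_le]
  positivity

/-- The Karush–Kuhn–Tucker conditions at an optimal input law. -/
theorem exists_kkt_multiplier (hp : IsNoiseDensity p) (hf : Measurable f)
    (hC : LowerSemicontinuous C) (hC0 : ∀ r, 0 ≤ C r) (hC_zero : C 0 = 0) (hA : 0 < A)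
    (hcap : capacity f p C A < ∞) {F : ProbabilityMeasure ℝ}
    (hF : IsCapacityAchieving f p C A F) :
    ∃ ν : ℝ, 0 ≤ ν ∧
      (∀ x, (condDiv f p (outputDensity f p (F : Measure ℝ)) x).toReal
        ≤ (capacity f p C A).toReal + ν * (C ‖x‖₊ - A)) ∧
      ∀ᵐ x ∂(F : Measure ℝ), (condDiv f p (outputDensity f p (F : Measure ℝ)) x).toReal
        = (capacity f p C A).toReal + ν * (C ‖x‖₊ - A) := by
  set q := outputDensity f p (F : Measure ℝ)
  have hfin : ∀ x, condDiv f p q x < ∞ :=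
    condDiv_outputDensity_lt_top hp hf hC hC0 hC_zero hA hcap hF
  obtain ⟨ν, hν0, hν⟩ := exists_multiplier (i := fun x => (condDiv f p q x).toReal)
    (c := fun x : ℝ => C ‖x‖₊) (A := A) (I := (capacity f p C A).toReal)
    ⟨0, by simpa [hC_zero] using hA⟩ fun x y θ h0 h1 hxy => by
      have h := ENNReal.toReal_mono hcap.ne
        (condDiv_two_point_le_capacity hp hf hC hC0 hA.le hcap hF h0 h1 hxy)
      rw [ENNReal.toReal_add (ENNReal.mul_lt_top ENNReal.ofReal_lt_top (hfin x)).ne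
        (ENNReal.mul_lt_top ENNReal.ofReal_lt_top (hfin y)).ne, ENNReal.toReal_mul,
        ENNReal.toReal_mul, ENNReal.toReal_ofReal h0, ENNReal.toReal_ofReal (by linarith)] at h
      exact h
  refine ⟨ν, hν0, hν, ?_⟩
  have hm : Measurable (condDiv f p q) :=
    measurable_condDiv hp hf (measurable_outputDensity (F : Measure ℝ) hp hf)
  have hlin : ∫⁻ x, condDiv f p q x ∂(F : Measure ℝ) = capacity f p C A := by
    rw [← mutualInfo_eq_lintegral_condDiv _ hp hf, hF.2]
  have hi : Integrable (fun x => (condDiv f p q x).toReal) (F : Measure ℝ) :=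
    integrable_toReal_of_lintegral_ne_top hm.aemeasurable (by rw [hlin]; exact hcap.ne)
  have hi_eq : ∫ x, (condDiv f p q x).toReal ∂(F : Measure ℝ) = (capacity f p C A).toReal := by
    rw [integral_toReal hm.aemeasurable (ae_of_all _ hfin), hlin]
  have hsub : Integrable (fun x : ℝ => C ‖x‖₊ - A) (F : Measure ℝ) :=
    hF.1.1.sub (integrable_const _)
  have hcost : Integrable (fun x : ℝ => (capacity f p C A).toReal + ν * (C ‖x‖₊ - A))
      (F : Measure ℝ) :=
    (integrable_const _).add (hsub.const_mul ν)
  have hcost_le : ∫ x : ℝ, ((capacity f p C A).toReal + ν * (C ‖x‖₊ - A)) ∂(F : Measure ℝ)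
      ≤ (capacity f p C A).toReal := by
    rw [integral_add (integrable_const _) (hsub.const_mul ν),
      integral_const_mul, integral_sub hF.1.1 (integrable_const _)]
    simp only [integral_const, probReal_univ, smul_eq_mul, one_mul, add_le_iff_nonpos_right]
    exact mul_nonpos_of_nonneg_of_nonpos hν0 (sub_nonpos.2 hF.1.2)
  have hgap : Integrable (fun x : ℝ => (capacity f p C A).toReal + ν * (C ‖x‖₊ - A)
      - (condDiv f p q x).toReal) (F : Measure ℝ) := hcost.sub hi
  have hzero : ∫ x : ℝ, ((capacity f p C A).toReal + ν * (C ‖x‖₊ - A)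
      - (condDiv f p q x).toReal) ∂(F : Measure ℝ) = 0 := by
    refine le_antisymm ?_ (integral_nonneg fun x => sub_nonneg.2 (hν x))
    rw [integral_sub hcost hi, hi_eq]
    linarith
  rw [integral_eq_zero_iff_of_nonneg (fun x => sub_nonneg.2 (hν x)) hgap] at hzero
  filter_upwards [hzero] with x hx
  exact (sub_eq_zero.1 hx).symm

end Optimality

/-! ### Growth of the divergence from an output law -/

section Envelope

variable {f p : ℝ → ℝ}

lemma lowerEnvelope_le_of_mem_Icc_zero (hp : IsNoiseDensity p) {x t : ℝ} (h0 : 0 ≤ t)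
    (ht : t ≤ x) : lowerEnvelope p x ≤ p t := by
  rw [lowerEnvelope, if_pos (h0.trans ht)]
  exact csInf_le ⟨0, by rintro _ ⟨s, -, rfl⟩; exact (hp.pos s).le⟩ ⟨t, ⟨h0, ht⟩, rfl⟩

lemma lowerEnvelope_le_of_mem_Icc_neg (hp : IsNoiseDensity p) {x t : ℝ} (h0 : t ≤ 0)
    (ht : x ≤ t) : lowerEnvelope p x ≤ p t := by
  rcases (ht.trans h0).lt_or_eq with hx | rfl
  · rw [lowerEnvelope, if_neg hx.not_ge]
    exact csInf_le ⟨0, by rintro _ ⟨s, -, rfl⟩; exact (hp.pos s).le⟩ ⟨t, ⟨ht, h0⟩, rfl⟩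
  · obtain rfl : t = 0 := le_antisymm h0 ht
    exact lowerEnvelope_le_of_mem_Icc_zero hp le_rfl le_rfl

lemma lowerEnvelope_le (hp : IsNoiseDensity p) (x : ℝ) : lowerEnvelope p x ≤ p x := by
  rcases le_total 0 x with h | h
  · exact lowerEnvelope_le_of_mem_Icc_zero hp h le_rfl
  · exact lowerEnvelope_le_of_mem_Icc_neg hp h le_rfl

lemma lowerEnvelope_pos (hp : IsNoiseDensity p) (x : ℝ) : 0 < lowerEnvelope p x := by
  rw [lowerEnvelope]
  split_ifs with h
  · obtain ⟨t, -, he⟩ := (isCompact_Icc (a := (0 : ℝ)) (b := x)).exists_sInf_image_eq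
      (Set.nonempty_Icc.2 h) hp.continuous.continuousOn
    exact he ▸ hp.pos t
  · obtain ⟨t, -, he⟩ := (isCompact_Icc (a := x) (b := (0 : ℝ))).exists_sInf_image_eq
      (Set.nonempty_Icc.2 (le_of_not_ge h)) hp.continuous.continuousOn
    exact he ▸ hp.pos t

lemma logInvLower_eq (p : ℝ → ℝ) (x : ℝ) :
    logInvLower p x = -Real.log (lowerEnvelope p x) := by
  rw [logInvLower, one_div, Real.log_inv]

/-- The lower envelope decreases away from the origin on both sides, so over a compact interval
`logInvLower p` is at most the larger of its values at the end points. -/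
lemma logInvLower_le_max (hp : IsNoiseDensity p) {a b x : ℝ} (hax : a ≤ x) (hxb : x ≤ b) :
    logInvLower p x ≤ max (logInvLower p a) (logInvLower p b) := by
  simp only [logInvLower_eq]
  rcases le_or_gt 0 x with hx | hx
  · refine le_max_of_le_right (neg_le_neg (Real.log_le_log (lowerEnvelope_pos hp b) ?_))
    conv_rhs => rw [lowerEnvelope, if_pos hx]
    refine le_csInf ((Set.nonempty_Icc.2 hx).image p) ?_
    rintro _ ⟨t, ht, rfl⟩
    exact lowerEnvelope_le_of_mem_Icc_zero hp ht.1 (ht.2.trans hxb)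
  · refine le_max_of_le_left (neg_le_neg (Real.log_le_log (lowerEnvelope_pos hp a) ?_))
    conv_rhs => rw [lowerEnvelope, if_neg hx.not_ge]
    refine le_csInf ((Set.nonempty_Icc.2 hx.le).image p) ?_
    rintro _ ⟨t, ht, rfl⟩
    exact lowerEnvelope_le_of_mem_Icc_neg hp ht.2 (hax.trans ht.1)

lemma neg_log_le_max_logInvLower (hp : IsNoiseDensity p) {a b x : ℝ} (hax : a ≤ x)
    (hxb : x ≤ b) : -Real.log (p x) ≤ max (logInvLower p a) (logInvLower p b) := by
  refine le_trans ?_ (logInvLower_le_max hp hax hxb)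
  rw [logInvLower_eq]
  exact neg_le_neg (Real.log_le_log (lowerEnvelope_pos hp x) (lowerEnvelope_le hp x))

lemma neg_log_le_logInvLower (hp : IsNoiseDensity p) {M : ℝ} (hM : ∀ x, p x ≤ M) (x : ℝ) :
    -Real.log M ≤ logInvLower p x := by
  rw [logInvLower_eq]
  exact neg_le_neg (Real.log_le_log (lowerEnvelope_pos hp x) ((lowerEnvelope_le hp x).trans (hM x)))

lemma le_upperEnvelope (hp : IsNoiseDensity p) (x : ℝ) : p x ≤ upperEnvelope p x := by
  obtain ⟨M, hM⟩ := hp.bdd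
  rw [upperEnvelope]
  split_ifs with h
  · exact le_csSup ⟨M, by rintro _ ⟨s, -, rfl⟩; exact hM s⟩ ⟨x, Set.self_mem_Ici, rfl⟩
  · exact le_csSup ⟨M, by rintro _ ⟨s, -, rfl⟩; exact hM s⟩ ⟨x, Set.self_mem_Iic, rfl⟩

lemma mul_logInvLower_le (hp : IsNoiseDensity p) (x : ℝ) :
    p x * logInvLower p x ≤ |upperEnvelope p x * Real.log (lowerEnvelope p x)| := by
  rw [logInvLower_eq, abs_mul]
  exact (mul_le_mul_of_nonneg_left (neg_le_abs _) (hp.pos x).le).trans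
    (mul_le_mul_of_nonneg_right ((le_upperEnvelope hp x).trans (le_abs_self _)) (abs_nonneg _))

/-- Quasi-subadditivity of `logInvLower p` for three summands, the middle one unrestricted. The
constant `m` makes `logInvLower p + m` nonnegative. If `|n|` is large, split `s + n + e` as
`(s + e) + n` and then `s + e`; otherwise `n + e` ranges over a compact set away from the origin. -/
lemma exists_logInvLower_add_le (hp : IsNoiseDensity p) {m κ R : ℝ} (hm0 : 0 ≤ m)
    (hm : ∀ x, 0 ≤ logInvLower p x + m) (hκ : 0 < κ)
    (hL : ∀ x y : ℝ, R ≤ |x| → R ≤ |y| →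
      logInvLower p (x + y) ≤ κ * (logInvLower p x + logInvLower p y)) {D : ℝ}
    (hD0 : 0 ≤ D) (hDR : 2 * R ≤ D) :
    ∃ a b : ℝ, 0 ≤ a ∧ 0 ≤ b ∧ ∀ s n e : ℝ, |R| + D ≤ |s| → |e| = D →
      logInvLower p (s + n + e) ≤ a + b * (logInvLower p s + m) + κ * (logInvLower p n + m) := by
  set Λ : ℝ → ℝ := fun x => logInvLower p x + m with hΛ
  have hΛ0 : ∀ x, 0 ≤ Λ x := hm
  have hsub : ∀ x y : ℝ, R ≤ |x| → R ≤ |y| → Λ (x + y) ≤ κ * (Λ x + Λ y) + m := by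
    intro x y hx hy
    have h1 := hL x y hx hy
    have h2 := mul_nonneg hκ.le hm0
    simp only [hΛ]
    linarith
  have hend : ∀ r x : ℝ, |x| ≤ r → Λ x ≤ Λ (-r) + Λ r := by
    intro r x hx
    have h := abs_le.1 hx
    have h1 := hΛ0 (-r)
    have h2 := hΛ0 r
    have h3 := logInvLower_le_max hp h.1 h.2
    simp only [hΛ] at h1 h2 ⊢
    rcases le_max_iff.1 h3 with h3 | h3 <;> linarith
  set c₁ := Λ (-D) + Λ D
  set c₂ := Λ (-(2 * D)) + Λ (2 * D)
  have hc₁ : 0 ≤ c₁ := add_nonneg (hΛ0 _) (hΛ0 _)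
  have hc₂ : 0 ≤ c₂ := add_nonneg (hΛ0 _) (hΛ0 _)
  refine ⟨κ * (κ * c₁ + m) + κ * c₂ + m, κ * κ + κ, by positivity, by positivity,
    fun s n e hs he => ?_⟩
  have hΛs := hΛ0 s
  have hΛn := hΛ0 n
  have hRs : R ≤ |s| := by linarith [le_abs_self R]
  suffices h : Λ (s + n + e) ≤ κ * (κ * c₁ + m) + κ * c₂ + m + (κ * κ + κ) * Λ s + κ * Λ n by
    simp only [hΛ] at h ⊢
    linarith
  rcases le_or_gt R |n| with hn | hn
  · have hse : R ≤ |s + e| := by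
      have h1 := abs_sub_abs_le_abs_sub s (-e)
      rw [abs_neg, sub_neg_eq_add] at h1
      linarith [le_abs_self R]
    have hRe : R ≤ |e| := by
      rw [he]
      rcases le_total 0 R with h | h <;> linarith
    have h1 := hsub (s + e) n hse hn
    have h2 := hsub s e hRs hRe
    rw [show s + e + n = s + n + e by ring] at h1
    have h3 := mul_le_mul_of_nonneg_left h2 hκ.le
    have h4 := mul_le_mul_of_nonneg_left (hend D e he.le) (mul_nonneg hκ.le hκ.le)
    have h5 := mul_nonneg hκ.le hc₂
    have h6 := mul_nonneg hκ.le hΛs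
    nlinarith
  · have hne : R ≤ |n + e| := by
      have h1 := abs_sub_abs_le_abs_sub e (-n)
      rw [abs_neg, sub_neg_eq_add, add_comm e n] at h1
      linarith
    have hne' : |n + e| ≤ 2 * D := by
      have := abs_add_le n e
      have := abs_nonneg n
      linarith
    have h1 := hsub s (n + e) hRs hne
    rw [← add_assoc] at h1
    have h2 := mul_le_mul_of_nonneg_left (hend _ _ hne') hκ.le
    have h3 := mul_nonneg (mul_nonneg hκ.le hκ.le) hc₁
    have h4 := mul_nonneg hκ.le hm0
    have h5 := mul_nonneg (mul_nonneg hκ.le hκ.le) hΛs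
    have h6 := mul_nonneg hκ.le hΛn
    nlinarith

/-- A law puts mass at least `1 / 2` on a compact set, on which `f` is bounded; this bounds the
output density from below in terms of the lower envelope. -/
lemma exists_neg_log_outputDensity_le (F : Measure ℝ) [IsProbabilityMeasure F]
    (hp : IsNoiseDensity p) (hf : Continuous f) :
    ∃ D₀ : ℝ, ∀ D, D₀ ≤ D → ∀ y, -Real.log (outputDensity f p F y)
      ≤ Real.log 2 + max (logInvLower p (y + -D)) (logInvLower p (y + D)) := by
  obtain ⟨K, hK, hFK⟩ := isTightMeasureSet_iff_exists_isCompact_measure_compl_le.1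
    (isTightMeasureSet_singleton (μ := F)) 2⁻¹ (by simp)
  have hFK' : (2 : ℝ)⁻¹ ≤ F.real K := by
    have h1 : F.real Kᶜ ≤ 2⁻¹ := by
      have := ENNReal.toReal_mono (by simp) (hFK F rfl)
      simpa [Measure.real] using this
    have h2 := probReal_compl_eq_one_sub (μ := F) hK.measurableSet
    linarith
  obtain ⟨D₀, hD₀⟩ := hK.exists_bound_of_continuousOn hf.continuousOn
  refine ⟨D₀, fun D hD y => ?_⟩
  set w := max (logInvLower p (y + -D)) (logInvLower p (y + D))
  have hle : Real.exp (-w) / 2 ≤ outputDensity f p F y := by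
    calc Real.exp (-w) / 2 ≤ F.real K * Real.exp (-w) := by
          have := mul_le_mul_of_nonneg_right hFK' (Real.exp_pos (-w)).le
          linarith
      _ = ∫ x, K.indicator (fun _ => Real.exp (-w)) x ∂F := by
          rw [integral_indicator_const _ hK.measurableSet, smul_eq_mul]
      _ ≤ _ := by
          refine integral_mono ((integrable_const _).indicator hK.measurableSet)
            (hp.integrable_comp F hf.measurable y) fun x => ?_
          by_cases hx : x ∈ K
          · have h1 := abs_le.1 ((hD₀ x hx).trans hD)
            have h2 : -Real.log (p (y - f x)) ≤ w :=
              neg_log_le_max_logInvLower hp (by linarith) (by linarith)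
            simp only [Set.indicator_of_mem hx]
            rw [← Real.le_log_iff_exp_le (hp.pos _)]
            linarith
          · simp only [Set.indicator_of_notMem hx]
            exact (hp.pos _).le
  have h := Real.log_le_log (by positivity) hle
  rw [Real.log_div (Real.exp_pos _).ne' two_ne_zero, Real.log_exp] at h
  linarith

/-- The divergence from an output law grows at most linearly in `ln (1 / p_l(f(x)))`. -/
theorem exists_toReal_condDiv_le (F : Measure ℝ) [IsProbabilityMeasure F]
    (hp : IsNoiseDensity p) (hf : Continuous f)
    (hL : ∃ κ > 0, ∃ R : ℝ, ∀ x y : ℝ, R ≤ |x| → R ≤ |y| →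
      logInvLower p (x + y) ≤ κ * (logInvLower p x + logInvLower p y))
    (hUL : Integrable fun x => upperEnvelope p x * Real.log (lowerEnvelope p x)) :
    ∃ c b S : ℝ, 0 ≤ b ∧ ∀ x, S ≤ |f x| →
      (condDiv f p (outputDensity f p F) x).toReal ≤ c + b * logInvLower p (f x) := by
  obtain ⟨κ, hκ, R, hL⟩ := hL
  obtain ⟨M, hM1, hM⟩ := hp.exists_one_le_bound
  set m := Real.log M with hm_def
  have hm0 : 0 ≤ m := Real.log_nonneg hM1
  have hm : ∀ x, 0 ≤ logInvLower p x + m := fun x => by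
    linarith [neg_log_le_logInvLower hp hM x]
  obtain ⟨D₀, hD₀⟩ := exists_neg_log_outputDensity_le F hp hf
  set D := max D₀ (max 0 (2 * R))
  have hDD : D₀ ≤ D := le_max_left _ _
  have hD0 : 0 ≤ D := (le_max_left _ _).trans (le_max_right _ _)
  have hDR : 2 * R ≤ D := (le_max_right _ _).trans (le_max_right _ _)
  obtain ⟨a, b, ha, hb, hab⟩ := exists_logInvLower_add_le hp hm0 hm hκ hL hD0 hDR
  set E := ∫ n, |upperEnvelope p n * Real.log (lowerEnvelope p n)|
  have hE : 0 ≤ E := integral_nonneg fun n => abs_nonneg _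
  have hlog2 : 0 ≤ Real.log 2 := Real.log_nonneg (by norm_num)
  refine ⟨m + Real.log 2 + a + b * m + κ * m + κ * E + 1, b, |R| + D, hb, fun x hx => ?_⟩
  set s := f x
  set q := outputDensity f p F
  set d := m + Real.log 2 + a + b * (logInvLower p s + m) + κ * m with hd
  have hd0 : 0 ≤ d := by have := hm s; positivity
  have hq0 : ∀ y, 0 < q y := outputDensity_pos F hp hf.measurable
  have hi1 : Integrable fun n => p n * d := hp.integrable.mul_const d
  have hi2 : Integrable fun n => κ * |upperEnvelope p n * Real.log (lowerEnvelope p n)| :=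
    hUL.abs.const_mul κ
  have hi3 : Integrable fun n => q (s + n) :=
    (integrable_outputDensity F hp hf.measurable).comp_add_left s
  have hq1 : ∫ n, q (s + n) = 1 := by
    rw [integral_add_left_eq_self q s]
    exact integral_outputDensity F hp hf.measurable
  have hbound : condDiv f p q x ≤ ENNReal.ofReal (d + κ * E + 1) := by
    refine (condDiv_le_ofReal_integral ((hi1.add hi2).add hi3) (fun n => ?_) fun n => ?_).trans
      (ENNReal.ofReal_le_ofReal (le_of_eq ?_))
    · have h1 := hp.pos n
      have h2 := hq0 (s + n)
      simp only [Pi.add_apply]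
      positivity
    · simp only [Pi.add_apply]
      refine (relEnt_le (hp.pos n) (hM n)).trans (add_le_add_left ?_ _)
      have h1 : -Real.log (q (s + n)) ≤ Real.log 2
          + (a + b * (logInvLower p s + m) + κ * (logInvLower p n + m)) :=
        (hD₀ D hDD (s + n)).trans (add_le_add_right (max_le
          (hab s n (-D) hx (by rw [abs_neg, abs_of_nonneg hD0]))
          (hab s n D hx (abs_of_nonneg hD0))) _)
      have h2 : m - Real.log (q (s + n)) ≤ d + κ * logInvLower p n := by
        rw [hd]
        linarith
      have h3 := mul_le_mul_of_nonneg_left h2 (hp.pos n).le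
      have h4 := mul_le_mul_of_nonneg_left (mul_logInvLower_le hp n) hκ.le
      linarith
    · rw [integral_add' (hi1.add hi2) hi3, integral_add' hi1 hi2, integral_mul_const,
        integral_const_mul, hp.integral_eq_one, hq1, one_mul]
  refine (ENNReal.toReal_le_of_le_ofReal (by positivity) hbound).trans (le_of_eq ?_)
  rw [hd]
  ring

end Envelope

section Unbounded

variable {f p : ℝ → ℝ}

/-- The divergence from a fixed output law is unbounded in the input. For an input whose output law
puts mass at least `1 / 2` where the fixed output law has mass at most `exp (-T)`, the variational
bound with test function `T` on that set gives divergence at least `T / 2 - 1`. -/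
lemma exists_le_condDiv_add_one (F : Measure ℝ) [IsProbabilityMeasure F] (hp : IsNoiseDensity p)
    (hf : Continuous f) (hf_lim : Tendsto (fun x => |f x|) (cocompact ℝ) atTop) {T : ℝ}
    (hT : 0 ≤ T) :
    ∃ x, ENNReal.ofReal T * 2⁻¹ ≤ condDiv f p (outputDensity f p F) x + 1 := by
  set q := outputDensity f p F
  have hq : Measurable q := measurable_outputDensity F hp hf.measurable
  have hq0 : ∀ y, 0 < q y := outputDensity_pos F hp hf.measurable
  have hP := isProbabilityMeasure_noiseLaw hp
  have hQ : IsProbabilityMeasure (volume.withDensity fun y => ENNReal.ofReal (q y)) := by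
    constructor
    rw [withDensity_apply _ .univ, Measure.restrict_univ,
      lintegral_outputDensity F hp hf.measurable]
  obtain ⟨K₁, hK₁, hPK⟩ := isTightMeasureSet_iff_exists_isCompact_measure_compl_le.1
    (isTightMeasureSet_singleton (μ := noiseLaw p)) 2⁻¹ (by simp)
  obtain ⟨K₂, hK₂, hQK⟩ := isTightMeasureSet_iff_exists_isCompact_measure_compl_le.1
    (isTightMeasureSet_singleton (μ := volume.withDensity fun y => ENNReal.ofReal (q y)))
    (ENNReal.ofReal (Real.exp (-T))) (by simpa using Real.exp_pos _)
  replace hPK := hPK _ rfl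
  replace hQK := hQK _ rfl
  rw [withDensity_apply _ hK₂.measurableSet.compl] at hQK
  have hPK' : 2⁻¹ ≤ ∫⁻ n in K₁, ENNReal.ofReal (p n) := by
    have h1 : noiseLaw p K₁ + noiseLaw p K₁ᶜ = 1 := prob_add_prob_compl hK₁.measurableSet
    have h2 : (2⁻¹ : ℝ≥0∞) + 2⁻¹ ≤ noiseLaw p K₁ + 2⁻¹ := by
      rw [ENNReal.inv_two_add_inv_two, ← h1]
      gcongr
    rw [← withDensity_apply _ hK₁.measurableSet]
    exact (ENNReal.add_le_add_iff_right (by simp)).1 h2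
  obtain ⟨r₁, hr₁⟩ := hK₁.isBounded.exists_norm_le
  obtain ⟨r₂, hr₂⟩ := hK₂.isBounded.exists_norm_le
  obtain ⟨x, hx⟩ := (hf_lim.eventually_gt_atTop (r₁ + r₂)).exists
  have hdisj : ∀ n ∈ K₁, f x + n ∈ K₂ᶜ := fun n hn hmem => by
    have h1 := hr₁ n hn
    have h2 := hr₂ _ hmem
    have h3 := abs_sub_abs_le_abs_sub (f x) (-n)
    rw [abs_neg, sub_neg_eq_add] at h3
    rw [Real.norm_eq_abs] at h1 h2
    linarith
  refine ⟨x, ?_⟩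
  have hmass : (2⁻¹ : ℝ≥0∞) ≤ ∫⁻ y in K₂ᶜ, ENNReal.ofReal (p (y - f x)) := by
    refine hPK'.trans ?_
    rw [← lintegral_indicator hK₁.measurableSet, ← lintegral_indicator hK₂.measurableSet.compl,
      ← lintegral_add_left_eq_self (K₂ᶜ.indicator fun y => ENNReal.ofReal (p (y - f x))) (f x)]
    refine lintegral_mono fun n => ?_
    by_cases hn : n ∈ K₁
    · rw [Set.indicator_of_mem hn, Set.indicator_of_mem (hdisj n hn), add_sub_cancel_left]
    · rw [Set.indicator_of_notMem hn]
      exact zero_le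
  have hexp : 0 ≤ Real.exp T - 1 := by linarith [Real.add_one_le_exp T]
  calc ENNReal.ofReal T * 2⁻¹
      ≤ ENNReal.ofReal T * ∫⁻ y in K₂ᶜ, ENNReal.ofReal (p (y - f x)) := by gcongr
    _ = ∫⁻ y in K₂ᶜ, ENNReal.ofReal T * ENNReal.ofReal (p (y - f x)) :=
        (lintegral_const_mul _
          (hp.continuous.comp (continuous_id.sub continuous_const)).measurable.ennreal_ofReal).symm
    _ ≤ ∫⁻ y in K₂ᶜ, (ENNReal.ofReal (relEnt (p (y - f x)) (q y))
          + ENNReal.ofReal (Real.exp T - 1) * ENNReal.ofReal (q y)) := by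
        refine lintegral_mono fun y => ?_
        have h := mul_sub_mul_exp_le_relEnt (hp.pos (y - f x)) (hq0 y) T
        rw [← ENNReal.ofReal_mul hT, ← ENNReal.ofReal_mul hexp,
          ← ENNReal.ofReal_add (relEnt_nonneg (hp.pos _) (hq0 y)) (mul_nonneg hexp (hq0 y).le)]
        exact ENNReal.ofReal_le_ofReal (by linarith)
    _ = (∫⁻ y in K₂ᶜ, ENNReal.ofReal (relEnt (p (y - f x)) (q y)))
          + ENNReal.ofReal (Real.exp T - 1) * ∫⁻ y in K₂ᶜ, ENNReal.ofReal (q y) := by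
        rw [lintegral_add_right _ (hq.ennreal_ofReal.const_mul _),
          lintegral_const_mul _ hq.ennreal_ofReal]
    _ ≤ condDiv f p q x + ENNReal.ofReal (Real.exp T) * ENNReal.ofReal (Real.exp (-T)) := by
        gcongr
        · exact setLIntegral_le_lintegral _ _
        · linarith
    _ = condDiv f p q x + 1 := by
        rw [← ENNReal.ofReal_mul (Real.exp_pos T).le, ← Real.exp_add, add_neg_cancel,
          Real.exp_zero, ENNReal.ofReal_one]

end Unbounded

/-! ### Compactness of the support -/

section CompactSupport

variable {f p : ℝ → ℝ} {C : ℝ≥0 → ℝ} {A : ℝ}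

/-- The support of an optimal input law is compact: the multiplier is positive because the
divergence is unbounded, and then equality in the Karush–Kuhn–Tucker conditions fails far out,
where the divergence is negligible with respect to the cost. -/
theorem isCompact_support_of_isCapacityAchieving (hp : IsNoiseDensity p) (hf : Continuous f)
    (hf_lim : Tendsto (fun x => |f x|) (cocompact ℝ) atTop)
    (hC : LowerSemicontinuous C) (hC0 : ∀ r, 0 ≤ C r) (hC_zero : C 0 = 0) (hA : 0 < A)
    (hC_top : Tendsto (fun x : ℝ => C ‖x‖₊) (cocompact ℝ) atTop)
    (hL : ∃ κ > 0, ∃ R : ℝ, ∀ x y : ℝ, R ≤ |x| → R ≤ |y| →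
      logInvLower p (x + y) ≤ κ * (logInvLower p x + logInvLower p y))
    (hUL : Integrable fun x => upperEnvelope p x * Real.log (lowerEnvelope p x))
    (hC_env : (fun x : ℝ => logInvLower p (f x)) =o[cocompact ℝ] fun x : ℝ => C ‖x‖₊)
    (hcap : capacity f p C A < ∞) {F : ProbabilityMeasure ℝ}
    (hF : IsCapacityAchieving f p C A F) : IsCompact (F : Measure ℝ).support := by
  obtain ⟨ν, hν0, hν, hν_eq⟩ := exists_kkt_multiplier hp hf.measurable hC hC0 hC_zero hA hcap hF
  set I := (capacity f p C A).toReal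
  have hfin := condDiv_outputDensity_lt_top hp hf.measurable hC hC0 hC_zero hA hcap hF
  have hνpos : 0 < ν := by
    refine hν0.lt_of_ne fun h0 => ?_
    have hI0 : 0 ≤ I := ENNReal.toReal_nonneg
    obtain ⟨x, hx⟩ := exists_le_condDiv_add_one (F : Measure ℝ) hp hf hf_lim
      (T := 2 * (I + 2)) (by positivity)
    have h1 := ENNReal.toReal_mono (ENNReal.add_lt_top.2 ⟨hfin x, ENNReal.one_lt_top⟩).ne hx
    rw [ENNReal.toReal_mul, ENNReal.toReal_ofReal (by positivity), ENNReal.toReal_inv,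
      ENNReal.toReal_add (hfin x).ne ENNReal.one_ne_top, ENNReal.toReal_ofNat,
      ENNReal.toReal_one] at h1
    have h2 := hν x
    rw [← h0] at h2
    linarith
  obtain ⟨c, b, S, hb, hcb⟩ := exists_toReal_condDiv_le (F : Measure ℝ) hp hf hL hUL
  have hev : ∀ᶠ x in cocompact ℝ,
      (condDiv f p (outputDensity f p (F : Measure ℝ)) x).toReal < I + ν * (C ‖x‖₊ - A) := by
    filter_upwards [hf_lim.eventually_ge_atTop S,
      hC_env.bound (show 0 < ν / (2 * (b + 1)) by positivity),
      hC_top.eventually_gt_atTop (2 * (c + ν * A - I) / ν)] with x h1 h2 h3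
    have h4 := hcb x h1
    rw [Real.norm_of_nonneg (hC0 _), Real.norm_eq_abs] at h2
    have h5 := mul_le_mul_of_nonneg_left ((le_abs_self _).trans h2) hb
    have h6 : b * (ν / (2 * (b + 1)) * C ‖x‖₊) ≤ ν / 2 * C ‖x‖₊ := by
      rw [← mul_assoc]
      refine mul_le_mul_of_nonneg_right ?_ (hC0 _)
      rw [← mul_div_assoc, div_le_div_iff₀ (by positivity) two_pos]
      nlinarith
    rw [div_lt_iff₀ hνpos] at h3
    linarith
  obtain ⟨K, hK, hKs⟩ := mem_cocompact.1 hev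
  have hae : K ∈ ae (F : Measure ℝ) := by
    filter_upwards [hν_eq] with x hx
    by_contra hxK
    have h : (condDiv f p (outputDensity f p (F : Measure ℝ)) x).toReal
      < I + ν * (C ‖x‖₊ - A) := hKs hxK
    exact h.ne hx
  exact hK.of_isClosed_subset Measure.isClosed_support
    (Measure.support_subset_of_isClosed hK.isClosed hae)

end CompactSupport

theorem theorem1
    (f : ℝ → ℝ) (C : ℝ≥0 → ℝ) (p : ℝ → ℝ) (A : ℝ) (hA : 0 < A)
    -- the input-output function
    (hf_cont : Continuous f)
    (hf_mono : ∀ x y : ℝ, |x| ≤ |y| → |f x| ≤ |f y|)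
    (hf_lim : Tendsto (fun x => |f x|) (cocompact ℝ) atTop)
    -- the cost function
    (hC_lsc : LowerSemicontinuous C)
    (hC_mono : Monotone C)
    (hC_zero : C 0 = 0)
    (hC_log : (fun x : ℝ => Real.log |f x|) =o[cocompact ℝ] fun x : ℝ => C ‖x‖₊)
    -- the noise density
    (hp_pos : ∀ x, 0 < p x)
    (hp_cont : Continuous p)
    (hp_bdd : ∃ M : ℝ, ∀ x, p x ≤ M)
    (hp_int : Integrable p)
    (hp_one : ∫ x, p x = 1)
    (hp_moment : ∃ CN : ℝ≥0 → ℝ, Monotone CN ∧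
      ((fun x : ℝ => Real.log |x|) =o[cocompact ℝ] fun x : ℝ => CN ‖x‖₊) ∧
      Integrable (fun x : ℝ => CN ‖x‖₊) (noiseLaw p))
    -- the envelopes of the noise density
    (hL : ∃ κ > 0, ∃ R : ℝ, ∀ x y : ℝ, R ≤ |x| → R ≤ |y| →
      logInvLower p (x + y) ≤ κ * (logInvLower p x + logInvLower p y))
    (hUL : Integrable fun x => upperEnvelope p x * Real.log (lowerEnvelope p x))
    -- the cost grows faster than `ln (1 / p_l(f(x)))`
    (hC_env : (fun x : ℝ => logInvLower p (f x)) =o[cocompact ℝ] fun x : ℝ => C ‖x‖₊) :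
    capacity f p C A < ∞ ∧
      (∃ F : ProbabilityMeasure ℝ, IsCapacityAchieving f p C A F) ∧
      ∀ F : ProbabilityMeasure ℝ, IsCapacityAchieving f p C A F →
        IsCompact (F : Measure ℝ).support := by
  have hp : IsNoiseDensity p := ⟨hp_pos, hp_cont, hp_bdd, hp_int, hp_one⟩
  have hC0 : ∀ r, 0 ≤ C r := fun r => hC_zero ▸ hC_mono r.2
  have hC_top : Tendsto (fun x : ℝ => C ‖x‖₊) (cocompact ℝ) atTop := by
    refine tendsto_atTop_mono' _ ?_ (Real.tendsto_log_atTop.comp hf_lim)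
    filter_upwards [hC_log.bound one_pos] with x hx
    rw [Real.norm_of_nonneg (hC0 _), one_mul] at hx
    exact (le_abs_self _).trans hx
  obtain ⟨CN, -, hCN_log, hCN_int⟩ := hp_moment
  have hlog : Integrable fun n => p n * Real.log (1 + n ^ 2) :=
    integrable_mul_log_one_add_sq hp hCN_log hCN_int
  have hΦC : ∀ ε > 0, ∃ B : ℝ, 0 ≤ B ∧ ∀ x : ℝ,
      condDiv f p cauchyRef x ≤ ENNReal.ofReal (B + ε * C ‖x‖₊) := by
    intro ε hε
    obtain ⟨c, hc0, hc⟩ := exists_condDiv_cauchyRef_le hp hlog f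
    obtain ⟨B, hB0, hB⟩ := exists_log_one_add_sq_le_add_mul hf_cont hf_lim hC_log hε
    refine ⟨c + B, add_nonneg hc0 hB0, fun x => (hc x).trans (ENNReal.ofReal_le_ofReal ?_)⟩
    have h := hB x
    rw [abs_of_nonneg (hC0 _)] at h
    linarith
  have hΦ : Continuous (condDiv f p cauchyRef) := continuous_condDiv_cauchyRef hp hf_cont hlog
  have hcap : capacity f p C A < ∞ := capacity_lt_top hp hf_cont hC_lsc hC0 hA.le
    continuous_cauchyRef.measurable cauchyRef_pos (hΦC 1 one_pos)
  exact ⟨hcap, exists_isCapacityAchieving hp hf_cont hC_lsc hC0 hC_zero hA.le hC_top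
      continuous_cauchyRef.measurable cauchyRef_pos hΦ hΦC,
    fun F hF => isCompact_support_of_isCapacityAchieving hp hf_cont hf_lim hC_lsc hC0 hC_zero hA
      hC_top hL hUL hC_env hcap hF⟩
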